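/- **Proposition (Hybrid returns UST).** Let $G$ be the complete graph with self-loops on a finite nonempty vertex set $V$ (every two vertices are adjacent and every vertex is adjacent to itself), let $r \in V$ and let $i \ge 0$ be an integer. Let $(X_t)_{t\ge 0}$ be the simple random walk on $G$ with $X_0=r$, let $V_t=\{X_0,\dots,X_t\}$, let $\eta=\inf\{t : V_t=V\}$ be the cover time, and put $\sigma^{\rm in}_0=0$ and, for $j\ge 1$, $$\sigma^{\rm out}_j=\inf\{t>\sigma^{\rm in}_{j-1} : X_t\notin V_{t-1}\}\wedge\eta,\qquad \sigma^{\rm in}_j=\inf\{t>\sigma^{\rm out}_j : X_t\in V_{t-1}\}\wedge\eta .$$ Let $\mathcal T^{AB}_{\sigma^{\rm in}_i}$ be the random tree built by the first $i$ branches of the Aldous–Broder algorithm: its vertex set is $V_{\sigma^{\rm in}_i}$ and its edges are the $\{X_t,X_{t+1}\}$ with $t<\sigma^{\rm in}_i$ and $X_{t+1}\notin V_t$. Run Wilson's algorithm on $G$ with initial condition $\mathcal T^{AB}_{\sigma^{\rm in}_i}$: starting from $(V_X,E_X)$ equal to the vertex set and the edge set of this tree, while $V_X\ne V$, choose $v\in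 V\setminus V_X$ uniformly at random, run a fresh simple random walk on $G$ from $v$ until it first visits $V_X$, erase its loops in chronological order, and add the vertices and the edges of the resulting path to $V_X$ and $E_X$; then return $(V_X,E_X)$. Then this procedure terminates almost surely, and the graph that it returns is a uniform spanning tree of $G$, that is, it is distributed uniformly on the set of all spanning trees of $G$. -/

import Mathlib

open MeasureTheory ProbabilityTheory

noncomputable section

namespace HybridUST

/-! ### Graphs with self-loops, spanning trees -/

/-- A graph on `V` without multiple edges, in which self-loops are allowed. -/
structure LoopGraph (V : Type*) where
  Adj : V → V → Prop
  symm : ∀ v w, Adj v w → Adj w v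

/-- The complete graph with self-loops: any two vertices are adjacent, and every vertex is adjacent
to itself. -/
def completeWithLoops (V : Type*) : LoopGraph V where
  Adj := fun _ _ => True
  symm := fun _ _ _ => trivial

/-- The graph obtained by deleting the self-loops. -/
def LoopGraph.toSimple {V : Type*} (G : LoopGraph V) : SimpleGraph V where
  Adj := fun v w => v ≠ w ∧ G.Adj v w
  symm := ⟨fun v w h => ⟨h.1.symm, G.symm v w h.2⟩⟩
  loopless := ⟨fun _ h => h.1 rfl⟩

/-- The set of spanning trees of `G`. (A tree has no self-loop.) -/
def spanningTrees {V : Type*} (G : LoopGraph V) : Set (SimpleGraph V) :=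
  {T | T ≤ G.toSimple ∧ T.IsTree}

/-- A pair (vertex set, edge set) on the ground set `V`: the variable `(V_X, E_X)` of the
algorithms. -/
@[ext]
structure PartialTree (V : Type*) where
  verts : Set V
  edges : Set (Sym2 V)

/-- A graph on all of `V`, as a pair (vertex set, edge set). -/
def ofSimpleGraph {V : Type*} (T : SimpleGraph V) : PartialTree V := ⟨Set.univ, T.edgeSet⟩

instance {V : Type*} : MeasurableSpace (SimpleGraph V) := ⊤

instance {V : Type*} : MeasurableSpace (PartialTree V) := ⊤

/-- The outcome of a randomized procedure which may fail to terminate: `none` means that it does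
not terminate, `some T` that it terminates and returns `T`. -/
abbrev Outcome (V : Type*) := Option (PartialTree V)

instance {V : Type*} : MeasurableSpace (Outcome V) := ⊤

/-- Run a procedure on the output of an earlier one (if the earlier one has terminated). -/
def andThen {V : Type*} (run : PartialTree V → Measure (Outcome V)) :
    Outcome V → Measure (Outcome V)
  | none => Measure.dirac none
  | some T => run T

/-- `UST(G)`: the uniform probability measure on the set of spanning trees of `G`. -/
def UST {V : Type*} (G : LoopGraph V) : Measure (SimpleGraph V) := uniformOn (spanningTrees G)

/-! ### Simple random walk -/

section Walk

variable {V : Type*} [Finite V] [MeasurableSpace V] [DiscreteMeasurableSpace V]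

open Classical in
/-- One step of simple random walk from `v`: uniform on the neighbours of `v` (a vertex with a
self-loop is a neighbour of itself). At a vertex without neighbours the walk stays put. -/
def stepLaw (G : LoopGraph V) (v : V) : Measure V :=
  if {w | G.Adj v w}.Nonempty then uniformOn {w | G.Adj v w} else Measure.dirac v

instance (G : LoopGraph V) (v : V) : IsProbabilityMeasure (stepLaw G v) := by
  unfold stepLaw
  split_ifs with h
  · exact isProbabilityMeasure_uniformOn (Set.toFinite _) h
  · infer_instance

/-- The transition kernel of simple random walk at time `t`, as a function of the past
`(x_0, …, x_t)`: it depends on `x_t` only. -/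
def stepKernel (G : LoopGraph V) (t : ℕ) :
    Kernel (Π _ : Finset.Iic t, V) V where
  toFun := fun x => stepLaw G (x ⟨t, Finset.mem_Iic.2 le_rfl⟩)
  measurable' := (Measurable.of_discrete (f := stepLaw G)).comp (measurable_pi_apply _)

instance (G : LoopGraph V) (t : ℕ) : IsMarkovKernel (stepKernel G t) :=
  ⟨fun x => inferInstanceAs (IsProbabilityMeasure (stepLaw G (x ⟨t, _⟩)))⟩

/-- The law, on the space of trajectories, of simple random walk on `G` started at `v`. -/
def walkLaw (G : LoopGraph V) (v : V) : Measure (ℕ → V) :=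
  Kernel.trajMeasure (X := fun _ => V) (Measure.dirac v) (stepKernel G)

end Walk

/-! ### Aldous-Broder and its branches -/

section AldousBroder

variable {V : Type*}

/-- `V_t`, the set of vertices visited up to time `t`. -/
def visited (X : ℕ → V) (t : ℕ) : Set V := {v | ∃ k ≤ t, X k = v}

/-- `X_t ∉ V_{t-1}`: the walk is at time `t` at a vertex that it visits for the first time. -/
def Fresh (X : ℕ → V) (t : ℕ) : Prop := ∀ k < t, X k ≠ X t

/-- The first time at which `p` holds (`⊤` if there is none). -/
def firstTime (p : ℕ → Prop) : ℕ∞ := sInf {s : ℕ∞ | ∃ t : ℕ, s = t ∧ p t}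

/-- The cover time `η`. -/
def coverTime (X : ℕ → V) : ℕ∞ := firstTime fun t => visited X t = Set.univ

/-- `inf {t > s : X_t ∉ V_{t-1}} ∧ η`. -/
def nextOut (X : ℕ → V) (s : ℕ∞) : ℕ∞ :=
  min (firstTime fun t => s < t ∧ Fresh X t) (coverTime X)

/-- `inf {t > s : X_t ∈ V_{t-1}} ∧ η`. -/
def nextIn (X : ℕ → V) (s : ℕ∞) : ℕ∞ :=
  min (firstTime fun t => s < t ∧ ¬ Fresh X t) (coverTime X)

/-- `σ^in_i`, the time at which the `i`-th branch is finished: `σ^in_0 = 0`,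
`σ^out_{i+1} = inf {t > σ^in_i : X_t ∉ V_{t-1}} ∧ η` and
`σ^in_{i+1} = inf {t > σ^out_{i+1} : X_t ∈ V_{t-1}} ∧ η`. -/
def sigmaIn (X : ℕ → V) : ℕ → ℕ∞
  | 0 => 0
  | i + 1 => nextIn X (nextOut X (sigmaIn X i))

/-- The tree built by Aldous-Broder up to time `t`: the visited vertices, and the edges
`{X_k, X_{k+1}}` through which a vertex is entered for the first time. -/
def aldousBroderTree (X : ℕ → V) (t : ℕ) : PartialTree V where
  verts := visited X t
  edges := {e | ∃ k < t, Fresh X (k + 1) ∧ e = s(X k, X (k + 1))}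

open Classical in
/-- The tree built by the first `i` branches, that is up to time `σ^in_i`. -/
def branchTree (i : ℕ) (X : ℕ → V) : Outcome V :=
  if sigmaIn X i = ⊤ then none else some (aldousBroderTree X (sigmaIn X i).toNat)

/-- The law of the random tree built by the first `i` branches of Aldous-Broder started at `r`. -/
def aldousBroderLaw [Finite V] [MeasurableSpace V] [DiscreteMeasurableSpace V]
    (G : LoopGraph V) (r : V) (i : ℕ) : Measure (Outcome V) :=
  (walkLaw G r).map (branchTree i)

end AldousBroder

/-! ### Wilson's algorithm with an initial tree -/

section Wilson

variable {V : Type*}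

open Classical in
/-- Extend a self-avoiding path by one step of the walk, to `v`. If `v` is on the path already, the
loop that is closed at `v` is erased: the path is cut back to its part that ends in `v`. -/
def eraseStep (p : List V) (v : V) : List V := p.takeWhile (fun u => u ≠ v) ++ [v]

/-- Chronological loop erasure of a finite walk. -/
def loopErase (w : List V) : List V := w.foldl eraseStep []

/-- The edges of a path. -/
def pathEdges (p : List V) : Set (Sym2 V) := {e | e ∈ List.zipWith (fun a b => s(a, b)) p p.tail}

open Classical in
/-- Follow the trajectory `X` until it first visits `T`, and add the loop erasure of this piece of
trajectory to `T`. -/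
def addBranch (T : PartialTree V) (X : ℕ → V) : Outcome V :=
  let τ := firstTime fun t => X t ∈ T.verts
  if τ = ⊤ then none else
    let p := loopErase ((List.range (τ.toNat + 1)).map X)
    some ⟨T.verts ∪ {v | v ∈ p}, T.edges ∪ pathEdges p⟩

variable [Finite V] [MeasurableSpace V] [DiscreteMeasurableSpace V]

/-- One round of the while loop: choose a vertex outside the tree uniformly at random, start a
random walk there, and add the loop-erased walk to the tree. -/
def wilsonRound (G : LoopGraph V) (T : PartialTree V) : Measure (Outcome V) :=
  (uniformOn T.vertsᶜ).bind fun v => (walkLaw G v).map (addBranch T)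

open Classical in
/-- The while loop, with at most `k` rounds; running out of rounds counts as non-termination. -/
def wilsonLoop (G : LoopGraph V) : ℕ → PartialTree V → Measure (Outcome V)
  | 0, T => Measure.dirac (if T.verts = Set.univ then some T else none)
  | k + 1, T =>
    if T.verts = Set.univ then Measure.dirac (some T)
    else (wilsonRound G T).bind (andThen (wilsonLoop G k))

/-- The law of the outcome of Wilson's algorithm on `G` with the (nonempty) initial tree `T`. Each
round of the while loop adds a vertex, so that there are at most `|V|` rounds. -/
def wilson (G : LoopGraph V) (T : PartialTree V) : Measure (Outcome V) :=
  wilsonLoop G (Nat.card V) T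

end Wilson

end HybridUST

end

/-!
The number of spanning trees of the complete graph on `n` vertices that contain a given tree with
`k` vertices is `k * n ^ (n - k - 1)`, so the conditional probability of a fixed spanning tree `S`,
given a partial tree `T`, is the reciprocal of this number if `T ⊆ S`, and `0` otherwise. The proof
shows that this likelihood is preserved in mean by a round of Wilson's algorithm started from any
tree and by the Aldous–Broder branches: in both cases its conditional expectation along the random
walk is an explicit bounded martingale, and optional stopping applies. Hence the combined procedure
ends at each spanning tree with the likelihood of the one-vertex tree, which does not depend on
`S`. The count of trees itself is never needed, only the recursion in `k` satisfied by the formula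
and its value `1` at `k = n`.
-/

namespace HybridUST

/-! ### Rooted trees -/

section Parent

variable {V : Type*} {S : SimpleGraph V} {r v w : V}

open Classical in
/-- The neighbour of `v` in `S` that is closer to the root `r`. It is unique if `S` is a tree and
`v ≠ r`; the junk value at the root is `r` itself. -/
noncomputable def parent (S : SimpleGraph V) (r v : V) : V :=
  if h : ∃ w, S.Adj v w ∧ S.dist r w < S.dist r v then h.choose else v

theorem parent_root (S : SimpleGraph V) (r : V) : parent S r r = r :=
  dif_neg fun ⟨_, _, hlt⟩ => by simp at hlt

theorem parent_spec (hS : S.Connected) (hv : v ≠ r) :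
    S.Adj v (parent S r v) ∧ S.dist r (parent S r v) < S.dist r v := by
  have hcloser : ∃ w, S.Adj v w ∧ S.dist r w < S.dist r v := by
    obtain ⟨p, hp⟩ := hS.exists_walk_length_eq_dist v r
    cases p with
    | nil => exact absurd rfl hv
    | cons hadj p =>
      refine ⟨_, hadj, ?_⟩
      rw [SimpleGraph.dist_comm, S.dist_comm (u := r), ← hp, SimpleGraph.Walk.length_cons]
      exact Nat.lt_succ_of_le (SimpleGraph.dist_le p)
  rw [parent, dif_pos hcloser]
  exact hcloser.choose_spec

theorem adj_parent (hS : S.Connected) (hv : v ≠ r) : S.Adj v (parent S r v) :=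
  (parent_spec hS hv).1

theorem dist_parent_lt (hS : S.Connected) (hv : v ≠ r) : S.dist r (parent S r v) < S.dist r v :=
  (parent_spec hS hv).2

theorem parent_eq_of_dist_lt (hS : S.IsTree) (hadj : S.Adj v w) (hlt : S.dist r w < S.dist r v) :
    parent S r v = w := by
  have hpath : ∀ u, S.Adj v u → S.dist r u < S.dist r v →
      ∃ p : S.Walk v r, p.IsPath ∧ p.snd = u := fun u hvu hu => by
    obtain ⟨p, hp⟩ := hS.connected.exists_walk_length_eq_dist u r
    refine ⟨p.cons hvu, SimpleGraph.Walk.isPath_of_length_eq_dist _ ?_, by simp⟩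
    have hle := SimpleGraph.dist_le (p.cons hvu)
    rw [SimpleGraph.Walk.length_cons, hp] at hle ⊢
    rw [S.dist_comm, S.dist_comm (u := r)] at hu
    lia
  have hv : v ≠ r := by rintro rfl; simp at hlt
  obtain ⟨p, hp, hpw⟩ := hpath w hadj hlt
  obtain ⟨q, hq, hqv⟩ := hpath _ (adj_parent hS.connected hv) (dist_parent_lt hS.connected hv)
  rw [← hqv, ← hpw, (hS.existsUnique_path v r).unique hq hp]

theorem parent_eq_or_parent_eq (hS : S.IsTree) (r : V) (hadj : S.Adj v w) :
    parent S r v = w ∨ parent S r w = v :=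
  (hS.dist_ne_of_adj r hadj).lt_or_gt.symm.imp (parent_eq_of_dist_lt hS hadj)
    (parent_eq_of_dist_lt hS hadj.symm)

theorem parent_induction (hS : S.Connected) {p : V → Prop} (root : p r)
    (step : ∀ v ≠ r, p (parent S r v) → p v) (v : V) : p v := by
  induction hd : S.dist r v using Nat.strong_induction_on generalizing v with
  | _ d ih =>
    by_cases hv : v = r
    · exact hv ▸ root
    · exact step v hv (ih _ (hd ▸ dist_parent_lt hS hv) _ rfl)

theorem dist_lt_of_isChain_parent (hS : S.Connected) {q : List V} (hr : r ∉ q)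
    (hchain : (q ++ [v]).IsChain fun a b => parent S r a = b) :
    ∀ u ∈ q, S.dist r v < S.dist r u := by
  induction q with
  | nil => simp
  | cons a q ih =>
    obtain ⟨har, hrq⟩ := List.ne_and_not_mem_of_not_mem_cons hr
    have hlt : S.dist r (parent S r a) < S.dist r a := dist_parent_lt hS har.symm
    rw [List.cons_append, List.isChain_cons] at hchain
    have hvq := ih hrq hchain.2
    rintro u (_ | ⟨_, hu⟩)
    · cases q with
      | nil => exact hchain.1 v rfl ▸ hlt
      | cons b q => exact (hvq b List.mem_cons_self).trans (hchain.1 b rfl ▸ hlt)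
    · exact hvq u hu

theorem parent_notMem_of_isChain (hS : S.Connected) {q : List V} (hr : r ∉ q)
    (hchain : (q ++ [v]).IsChain fun a b => parent S r a = b) : v ∉ q :=
  fun hv => (dist_lt_of_isChain_parent hS hr hchain v hv).false

end Parent

/-! ### Partial trees -/

section PartialTree

variable {V : Type*}

/-- The tree with the single vertex `r`. -/
def rootTree (r : V) : PartialTree V := ⟨{r}, ∅⟩

/-- The partial tree `T` with the new vertex `y`, attached at `x`. -/
def PartialTree.addLeaf (T : PartialTree V) (x y : V) : PartialTree V :=
  ⟨insert y T.verts, insert s(x, y) T.edges⟩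

/-- The partial tree `T` with the vertices and the edges of the path `p`. -/
def PartialTree.addPath (T : PartialTree V) (p : List V) : PartialTree V :=
  ⟨T.verts ∪ {v | v ∈ p}, T.edges ∪ pathEdges p⟩

/-- The partial trees that are obtained from the one-vertex tree at `r` by adding leaves. -/
inductive GrownFrom (r : V) : PartialTree V → Prop
  | root : GrownFrom r (rootTree r)
  | leaf {T : PartialTree V} {x y : V} (hT : GrownFrom r T) (hx : x ∈ T.verts)
      (hy : y ∉ T.verts) : GrownFrom r (T.addLeaf x y)

variable {r : V} {T : PartialTree V}

theorem GrownFrom.root_mem (hT : GrownFrom r T) : r ∈ T.verts := by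
  induction hT with
  | root => exact Set.mem_singleton r
  | leaf _ _ _ ih => exact Or.inr ih

theorem GrownFrom.mem_verts_of_mem_edge (hT : GrownFrom r T) {e : Sym2 V} (he : e ∈ T.edges)
    {v : V} (hv : v ∈ e) : v ∈ T.verts := by
  induction hT with
  | root => exact absurd he (Set.notMem_empty e)
  | leaf _ hx _ ih =>
    rcases he with rfl | he
    · rcases Sym2.mem_iff.1 hv with rfl | rfl
      · exact Or.inr hx
      · exact Or.inl rfl
    · exact Or.inr (ih he)

theorem GrownFrom.not_isDiag (hT : GrownFrom r T) {e : Sym2 V} (he : e ∈ T.edges) :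
    ¬ e.IsDiag := by
  induction hT with
  | root => exact absurd he (Set.notMem_empty e)
  | leaf _ hx hy ih =>
    rcases he with rfl | he
    · exact fun hxy => hy (Sym2.mk_isDiag_iff.1 hxy ▸ hx)
    · exact ih he

theorem GrownFrom.ncard_edges_add_one [Finite V] (hT : GrownFrom r T) :
    T.edges.ncard + 1 = T.verts.ncard := by
  induction hT with
  | root => simp [rootTree]
  | leaf hT _ hy ih =>
    rw [PartialTree.addLeaf, Set.ncard_insert_of_notMem hy, ← ih, Set.ncard_insert_of_notMem]
    exact fun he => hy (hT.mem_verts_of_mem_edge he (Sym2.mem_mk_right _ _))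

theorem GrownFrom.reachable (hT : GrownFrom r T) :
    ∀ v ∈ T.verts, (SimpleGraph.fromEdgeSet T.edges).Reachable r v := by
  induction hT with
  | root => rintro v rfl; exact SimpleGraph.Reachable.refl _
  | leaf _ hx hy ih =>
    rename_i T x y _
    have hle : SimpleGraph.fromEdgeSet T.edges ≤ SimpleGraph.fromEdgeSet (T.addLeaf x y).edges :=
      SimpleGraph.fromEdgeSet_mono (Set.subset_insert _ _)
    rintro v (rfl | hv)
    · have hadj : (SimpleGraph.fromEdgeSet (T.addLeaf x v).edges).Adj x v :=
        (SimpleGraph.fromEdgeSet_adj _).2 ⟨Set.mem_insert _ _, fun hxv => hy (hxv ▸ hx)⟩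
      exact ((ih x hx).mono hle).trans hadj.reachable
    · exact (ih v hv).mono hle

theorem GrownFrom.exists_isTree [Finite V] (hT : GrownFrom r T) (hfull : T.verts = Set.univ) :
    ∃ S : SimpleGraph V, S.IsTree ∧ T = ofSimpleGraph S := by
  have hedges : (SimpleGraph.fromEdgeSet T.edges).edgeSet = T.edges := by
    rw [SimpleGraph.edgeSet_fromEdgeSet, sdiff_eq_left, Set.disjoint_left]
    exact fun e he => hT.not_isDiag he
  have hconn : (SimpleGraph.fromEdgeSet T.edges).Connected :=
    SimpleGraph.connected_iff_exists_forall_reachable _ |>.2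
      ⟨r, fun v => hT.reachable v (hfull ▸ Set.mem_univ v)⟩
  refine ⟨SimpleGraph.fromEdgeSet T.edges, ?_, PartialTree.ext hfull hedges.symm⟩
  rw [SimpleGraph.isTree_iff_connected_and_card, hedges, Nat.card_coe_set_eq,
    hT.ncard_edges_add_one, hfull, Set.ncard_univ]
  exact ⟨hconn, rfl⟩

theorem GrownFrom.edges_subset_iff_of_verts_eq_univ [Finite V] (hT : GrownFrom r T)
    (hfull : T.verts = Set.univ) {S : SimpleGraph V} (hS : S.IsTree) :
    T.edges ⊆ S.edgeSet ↔ T = ofSimpleGraph S := by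
  obtain ⟨S', hS', rfl⟩ := hT.exists_isTree hfull
  refine ⟨fun hle => ?_, fun h => (congrArg PartialTree.edges h).subset⟩
  have hS'S : S' ≤ S := SimpleGraph.edgeSet_subset_edgeSet.1 hle
  rw [hS'S.antisymm ((SimpleGraph.isTree_iff_minimal_connected.1 hS).2 hS'.connected hS'S)]

variable {S : SimpleGraph V}

theorem GrownFrom.parent_mem (hT : GrownFrom r T) (hS : S.IsTree) (hsub : T.edges ⊆ S.edgeSet)
    {v : V} (hv : v ∈ T.verts) : parent S r v ∈ T.verts := by
  induction hT generalizing v with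
  | root => rw [Set.mem_singleton_iff.1 hv, parent_root]; exact Set.mem_singleton r
  | leaf _ hx hy ih =>
    rename_i T x y _
    have hparent {u : V} (hu : u ∈ T.verts) : parent S r u ∈ T.verts :=
      ih ((Set.subset_insert _ _).trans hsub) hu
    rcases hv with rfl | hv
    · have hadj : S.Adj x v := hsub (Set.mem_insert _ _)
      rcases parent_eq_or_parent_eq hS r hadj with h | h
      · exact absurd (h ▸ hparent hx) hy
      · exact Or.inr (h ▸ hx)
    · exact Or.inr (hparent hv)

theorem GrownFrom.addLeaf_edges_subset_iff (hT : GrownFrom r T) (hS : S.IsTree) {x y : V}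
    (hx : x ∈ T.verts) (hy : y ∉ T.verts) :
    (T.addLeaf x y).edges ⊆ S.edgeSet ↔ T.edges ⊆ S.edgeSet ∧ parent S r y = x := by
  rw [PartialTree.addLeaf, Set.insert_subset_iff, and_comm]
  refine and_congr_right fun hsub => ⟨fun hxy : S.Adj x y => ?_, ?_⟩
  · rcases parent_eq_or_parent_eq hS r hxy with h | h
    · exact absurd (h ▸ hT.parent_mem hS hsub hx) hy
    · exact h
  · rintro rfl
    have hyr : y ≠ r := fun h => hy (h ▸ hT.root_mem)
    exact (adj_parent hS.connected hyr).symm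

theorem PartialTree.addPath_singleton_of_mem {a : V} (ha : a ∈ T.verts) : T.addPath [a] = T := by
  ext1
  · simpa [PartialTree.addPath] using ha
  · simp [PartialTree.addPath, pathEdges]

theorem PartialTree.addPath_cons (T : PartialTree V) (b : V) {p : List V} (hp : p ≠ []) :
    T.addPath (b :: p) = (T.addPath p).addLeaf (p.head hp) b := by
  cases p with
  | nil => exact absurd rfl hp
  | cons a p =>
    ext : 2
    · simp [PartialTree.addPath, PartialTree.addLeaf, or_left_comm]
    · simp [PartialTree.addPath, PartialTree.addLeaf, pathEdges, or_left_comm, Sym2.eq_swap]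

theorem PartialTree.verts_addPath_append_singleton {a : V} (ha : a ∈ T.verts) (q : List V) :
    (T.addPath (q ++ [a])).verts = T.verts ∪ {v | v ∈ q} := by
  ext v
  simp only [addPath, List.mem_append, List.mem_singleton, Set.mem_union, Set.mem_ofPred_eq]
  exact ⟨by rintro (hv | hv | rfl) <;> tauto, by tauto⟩

theorem PartialTree.ncard_verts_addPath_append_singleton [Finite V] {a : V} (ha : a ∈ T.verts)
    {q : List V} (hq : q.Nodup) (hoff : ∀ v ∈ q, v ∉ T.verts) :
    (T.addPath (q ++ [a])).verts.ncard = T.verts.ncard + q.length := by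
  classical
  have hdisj : Disjoint T.verts {v | v ∈ q} := Set.disjoint_left.2 fun v hv hvq => hoff v hvq hv
  have hcoe : {v | v ∈ q} = (q.toFinset : Set V) := by ext; simp
  rw [verts_addPath_append_singleton ha, Set.ncard_union_eq hdisj, hcoe, Set.ncard_coe_finset,
    List.toFinset_card_of_nodup hq]

theorem PartialTree.notMem_verts_addPath_of_nodup_cons {a b : V} (ha : a ∈ T.verts) {q : List V}
    (hq : (b :: q).Nodup) (hoff : ∀ v ∈ b :: q, v ∉ T.verts) :
    b ∉ (T.addPath (q ++ [a])).verts := by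
  rw [verts_addPath_append_singleton ha]
  rintro (hb | hb)
  · exact hoff b List.mem_cons_self hb
  · exact (List.nodup_cons.1 hq).1 hb

theorem PartialTree.head_mem_verts_addPath (T : PartialTree V) {p : List V} (hp : p ≠ []) :
    p.head hp ∈ (T.addPath p).verts :=
  Or.inr (List.head_mem hp)

theorem GrownFrom.addPath (hT : GrownFrom r T) {a : V} (ha : a ∈ T.verts) {q : List V}
    (hq : q.Nodup) (hoff : ∀ v ∈ q, v ∉ T.verts) : GrownFrom r (T.addPath (q ++ [a])) := by
  induction q with
  | nil => rwa [List.nil_append, PartialTree.addPath_singleton_of_mem ha]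
  | cons b q ih =>
    rw [List.cons_append, T.addPath_cons b (by simp)]
    exact (ih hq.of_cons fun v hv => hoff v (List.mem_cons_of_mem _ hv)).leaf
      (T.head_mem_verts_addPath _) (PartialTree.notMem_verts_addPath_of_nodup_cons ha hq hoff)

theorem GrownFrom.addPath_edges_subset_iff (hT : GrownFrom r T) (hS : S.IsTree) {a : V}
    (ha : a ∈ T.verts) {q : List V} (hq : q.Nodup) (hoff : ∀ v ∈ q, v ∉ T.verts) :
    (T.addPath (q ++ [a])).edges ⊆ S.edgeSet ↔
      T.edges ⊆ S.edgeSet ∧ (q ++ [a]).IsChain fun u v => parent S r u = v := by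
  induction q with
  | nil => simp [PartialTree.addPath_singleton_of_mem ha]
  | cons b q ih =>
    have hoff' : ∀ v ∈ q, v ∉ T.verts := fun v hv => hoff v (List.mem_cons_of_mem _ hv)
    rw [List.cons_append, T.addPath_cons b (by simp),
      (hT.addPath ha hq.of_cons hoff').addLeaf_edges_subset_iff hS (T.head_mem_verts_addPath _)
        (PartialTree.notMem_verts_addPath_of_nodup_cons ha hq hoff),
      ih hq.of_cons hoff', List.isChain_cons, List.head?_eq_some_head (by simp)]
    simp [and_assoc, and_comm]

end PartialTree

/-! ### The likelihood of a spanning tree -/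

section Likelihood

theorem natCast_card_ne_zero {V : Type*} [Finite V] (v : V) : (Nat.card V : ℝ) ≠ 0 :=
  have : Nonempty V := ⟨v⟩
  Nat.cast_ne_zero.2 Nat.card_pos.ne'

/-- The reciprocal of the number `k * n ^ (n - k - 1)` of spanning trees of the complete graph on
the `n` vertices `V` that contain a given tree with `k` vertices. It is written without truncated
subtraction. -/
noncomputable def completionProb (V : Type*) (k : ℕ) : ℝ :=
  (Nat.card V : ℝ) ^ (k + 1) / (k * (Nat.card V : ℝ) ^ Nat.card V)

theorem completionProb_nonneg (V : Type*) (k : ℕ) : 0 ≤ completionProb V k := by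
  unfold completionProb; positivity

variable {V : Type*}

open Classical in
/-- The conditional probability that the uniform spanning tree is `S`, given the partial tree `T`
that it contains. -/
noncomputable def likelihood (S : SimpleGraph V) : Outcome V → ℝ
  | none => 0
  | some T => if T.edges ⊆ S.edgeSet then completionProb V T.verts.ncard else 0

theorem likelihood_nonneg (S : SimpleGraph V) (o : Outcome V) : 0 ≤ likelihood S o := by
  cases o with
  | none => exact le_rfl
  | some T =>
    rw [likelihood]
    split_ifs
    exacts [completionProb_nonneg V _, le_rfl]

theorem succ_mul_completionProb_succ {k : ℕ} (hk : k ≠ 0) :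
    (k + 1 : ℝ) * completionProb V (k + 1) = Nat.card V * (k * completionProb V k) := by
  unfold completionProb
  push_cast
  field_simp
  ring

theorem completionProb_card [Finite V] [Nonempty V] : completionProb V (Nat.card V) = 1 := by
  have hpos : (Nat.card V : ℝ) ≠ 0 := Nat.cast_ne_zero.2 Nat.card_pos.ne'
  rw [completionProb, pow_succ', div_self (by positivity)]

end Likelihood

/-! ### Entry points -/

section EntryPoint

variable {V : Type*} {S : SimpleGraph V} {r v : V} {A : Set V}

open Classical in
/-- The first vertex of `A` on the path in `S` from `v` to the root `r`; the junk value is `v`. -/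
noncomputable def entryPoint (S : SimpleGraph V) (r : V) (A : Set V) (v : V) : V :=
  if h : ∃ k, (parent S r)^[k] v ∈ A then (parent S r)^[Nat.find h] v else v

theorem entryPoint_of_mem (hv : v ∈ A) : entryPoint S r A v = v := by
  classical
  have h : ∃ k, (parent S r)^[k] v ∈ A := ⟨0, hv⟩
  have hzero : Nat.find h = 0 := (Nat.find_eq_zero h).2 hv
  rw [entryPoint, dif_pos h, hzero, Function.iterate_zero_apply]

theorem exists_iterate_parent_mem (hS : S.Connected) (hr : r ∈ A) (v : V) :
    ∃ k, (parent S r)^[k] v ∈ A :=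
  parent_induction hS (p := fun v => ∃ k, (parent S r)^[k] v ∈ A) ⟨0, hr⟩
    (fun _ _ ⟨k, hk⟩ => ⟨k + 1, hk⟩) v

theorem entryPoint_of_notMem (hS : S.Connected) (hr : r ∈ A) (hv : v ∉ A) :
    entryPoint S r A v = entryPoint S r A (parent S r v) := by
  classical
  have h := exists_iterate_parent_mem hS hr v
  have h' := exists_iterate_parent_mem hS hr (parent S r v)
  have hfind : Nat.find h = Nat.find h' + 1 := Nat.find_comp_succ h h' hv
  rw [entryPoint, dif_pos h, entryPoint, dif_pos h', hfind, Function.iterate_succ_apply]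

theorem entryPoint_mem (hS : S.Connected) (hr : r ∈ A) (v : V) : entryPoint S r A v ∈ A := by
  classical
  have h := exists_iterate_parent_mem hS hr v
  rw [entryPoint, dif_pos h]
  exact Nat.find_spec h

variable [Fintype V]

open Classical in
/-- The number of vertices whose path to the root enters `A` at `y`. -/
noncomputable def entryCount (S : SimpleGraph V) (r : V) (A : Set V) (y : V) : ℕ :=
  (Finset.univ.filter fun v => entryPoint S r A v = y).card

open Classical in
theorem sum_entryCount (hS : S.Connected) (hr : r ∈ A) :
    ∑ y with y ∈ A, entryCount S r A y = Nat.card V := by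
  have hmaps : ∀ v ∈ Finset.univ, entryPoint S r A v ∈ Finset.univ.filter (· ∈ A) := fun v _ =>
    Finset.mem_filter_univ _ |>.2 (entryPoint_mem hS hr v)
  rw [Nat.card_eq_fintype_card, ← Finset.card_univ, Finset.card_eq_sum_card_fiberwise hmaps]
  rfl

open Classical in
theorem sum_ite_entryPoint_insert_of_mem {y : V} (hv : v ∈ A) :
    (∑ w with w ∉ A ∧ parent S r w = y,
      if entryPoint S r (insert w A) v = w then 1 else 0) = 0 := by
  refine Finset.sum_eq_zero fun w hw => if_neg ?_
  rw [entryPoint_of_mem (Set.mem_insert_of_mem w hv)]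
  rintro rfl
  exact ((Finset.mem_filter_univ _).1 hw).1 hv

open Classical in
theorem sum_ite_entryPoint_insert_of_notMem (hS : S.Connected) (hr : r ∈ A) {y : V} (hy : y ∈ A)
    (hv : v ∉ A) :
    (∑ w with w ∉ A ∧ parent S r w = y, if entryPoint S r (insert w A) v = w then 1 else 0) =
      (if parent S r v = y then 1 else 0) + ∑ w with w ∉ A ∧ parent S r w = y,
        if entryPoint S r (insert w A) (parent S r v) = w then 1 else 0 := by
  have hterm : ∀ w, parent S r w = y → (if entryPoint S r (insert w A) v = w then 1 else 0) =
      (if w = v then 1 else 0) +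
        if entryPoint S r (insert w A) (parent S r v) = w then 1 else 0 := fun w hw => by
    by_cases hwv : w = v
    · subst hwv
      have hpw : parent S r w ∈ insert w A := Or.inr (hw ▸ hy)
      have hne : parent S r w ≠ w := fun h => hv (h ▸ hw ▸ hy)
      simp [entryPoint_of_mem hpw, entryPoint_of_mem (Set.mem_insert w A), hne]
    · have hvA : v ∉ insert w A := fun h => h.elim (hwv ·.symm) hv
      rw [entryPoint_of_notMem hS (Set.mem_insert_of_mem w hr) hvA, if_neg hwv, zero_add]
  rw [Finset.sum_congr rfl fun w hw => hterm w ((Finset.mem_filter_univ _).1 hw).2,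
    Finset.sum_add_distrib, Finset.sum_ite_eq']
  simp only [Finset.mem_filter_univ, hv, not_false_eq_true, true_and]

open Classical in
/-- A vertex whose path enters `A` at `y` is either `y` itself, or its path passes through exactly
one of the children of `y` outside `A`. -/
theorem ite_entryPoint_eq (hS : S.Connected) (hr : r ∈ A) {y : V} (hy : y ∈ A) (v : V) :
    (if entryPoint S r A v = y then 1 else 0) = (if v = y then 1 else 0) +
      ∑ w with w ∉ A ∧ parent S r w = y, if entryPoint S r (insert w A) v = w then 1 else 0 := by
  have of_mem : ∀ v ∈ A, (if entryPoint S r A v = y then 1 else 0) = (if v = y then 1 else 0) +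
      ∑ w with w ∉ A ∧ parent S r w = y,
        if entryPoint S r (insert w A) v = w then 1 else 0 := fun v hv => by
    rw [entryPoint_of_mem hv, sum_ite_entryPoint_insert_of_mem hv, add_zero]
  induction v using parent_induction hS (r := r) with
  | root => exact of_mem r hr
  | step v _ ih =>
    by_cases hv : v ∈ A
    · exact of_mem v hv
    · have hvy : v ≠ y := fun h => hv (h ▸ hy)
      rw [entryPoint_of_notMem hS hr hv, ih, sum_ite_entryPoint_insert_of_notMem hS hr hy hv,
        if_neg hvy, zero_add]

open Classical in
theorem entryCount_eq_one_add_sum (hS : S.Connected) (hr : r ∈ A) {y : V} (hy : y ∈ A) :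
    entryCount S r A y =
      1 + ∑ w with w ∉ A ∧ parent S r w = y, entryCount S r (insert w A) w := by
  simp only [entryCount, Finset.card_filter]
  rw [Finset.sum_comm, Finset.sum_congr rfl fun v _ => ite_entryPoint_eq hS hr hy v,
    Finset.sum_add_distrib, Finset.sum_ite_eq' Finset.univ y, if_pos (Finset.mem_univ y)]

theorem entryCount_univ (y : V) : entryCount S r Set.univ y = 1 := by
  classical
  simp only [entryCount, entryPoint_of_mem (Set.mem_univ _)]
  exact Finset.card_eq_one.2 ⟨y, by ext; simp⟩

end EntryPoint

/-! ### Simple random walk -/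

section Walk

open Filter

variable {V : Type*} [Finite V] [MeasurableSpace V] [DiscreteMeasurableSpace V]

theorem measurable_of_dependsOn_Iic {β : Type*} [MeasurableSpace β] {f : (ℕ → V) → β} {t : ℕ}
    (hf : DependsOn f (Set.Iic t)) : Measurable f := by
  cases isEmpty_or_nonempty (ℕ → V)
  · exact measurable_of_empty f
  · have : Nonempty β := .map f inferInstance
    obtain ⟨g, rfl⟩ := dependsOn_iff_exists_comp.1 hf
    have hrestrict : Measurable ((Set.Iic t).domRestrict (π := fun _ => V)) :=
      measurable_pi_lambda _ fun j => measurable_pi_apply _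
    exact Measurable.of_discrete.comp hrestrict

variable {G : LoopGraph V} {v : V}

instance : IsProbabilityMeasure (walkLaw G v) := by
  unfold walkLaw; infer_instance

theorem ae_walkLaw_zero_eq : ∀ᵐ x ∂walkLaw G v, x 0 = v := by
  have hmap : (walkLaw G v).map (fun x => x 0) = Measure.dirac v := by
    have hcomp : (fun x : ℕ → V => x 0) =
        (fun y : (Π _ : Finset.Iic 0, V) => y ⟨0, by simp⟩) ∘ Preorder.frestrictLe 0 := rfl
    rw [hcomp, ← Measure.map_map (by fun_prop) (by fun_prop), walkLaw, Kernel.trajMeasure,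
      Measure.map_comp _ _ (by fun_prop), Kernel.traj_map_frestrictLe, Kernel.partialTraj_self,
      Measure.id_comp, Measure.map_map (by fun_prop) (by fun_prop),
      Measure.map_dirac' (by fun_prop)]
    rfl
  have hdirac : ∀ᵐ u ∂(walkLaw G v).map (fun x => x 0), u = v := by
    rw [hmap, ae_dirac_eq]
    exact rfl
  exact ae_of_ae_map (measurable_pi_apply 0).aemeasurable hdirac

theorem integral_walkLaw_succ {g : (ℕ → V) → ℝ} {t : ℕ} (hg : DependsOn g (Set.Iic (t + 1))) :
    ∫ x, g x ∂walkLaw G v =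
      ∫ x, ∫ w, g (Function.update x (t + 1) w) ∂stepLaw G (x t) ∂walkLaw G v := by
  let extend : (Π _ : Finset.Iic t, V) × V → ℕ → V := fun y s =>
    if h : s ≤ t then y.1 ⟨s, Finset.mem_Iic.2 h⟩ else y.2
  have hextend : ∀ x w, g (Function.update x (t + 1) w) =
      g (extend (Preorder.frestrictLe t x, w)) := fun x w => hg fun s (hs : s ≤ t + 1) => by
    rcases hs.lt_or_eq with hlt | rfl
    · simp [extend, Nat.lt_succ_iff.1 hlt, hlt.ne]
    · simp [extend]
  have hagree : Measurable fun x : ℕ → V =>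
      (Preorder.frestrictLe (π := fun _ => V) t x, x (t + 1)) := by fun_prop
  have hlaw := Kernel.map_frestrictLe_trajMeasure_compProd_eq_map_trajMeasure
    (X := fun _ => V) (μ₀ := Measure.dirac v) (κ := stepKernel G) (a := t)
  calc ∫ x, g x ∂walkLaw G v
      = ∫ x, g (extend (Preorder.frestrictLe t x, x (t + 1))) ∂walkLaw G v := by
        simp only [← hextend, Function.update_eq_self]
    _ = ∫ y, g (extend y) ∂(walkLaw G v).map
          fun x => (Preorder.frestrictLe (π := fun _ => V) t x, x (t + 1)) :=
        (integral_map (f := fun y => g (extend y)) hagree.aemeasurable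
          Measurable.of_discrete.aestronglyMeasurable).symm
    _ = ∫ y, ∫ w, g (extend (y, w)) ∂stepKernel G t y
          ∂(walkLaw G v).map (Preorder.frestrictLe t) := by
        rw [walkLaw, ← hlaw, Measure.integral_compProd .of_finite]
    _ = _ := by
        rw [integral_map (by fun_prop) Measurable.of_discrete.aestronglyMeasurable]
        simp only [hextend]
        rfl

/-- Optional stopping: `M` is a bounded martingale of the walk, and `F` is its limit. -/
theorem integral_eq_of_eventually_eq {M : ℕ → (ℕ → V) → ℝ} {F : (ℕ → V) → ℝ} {c C : ℝ}
    (hdep : ∀ t, DependsOn (M t) (Set.Iic t)) (hzero : ∀ x, x 0 = v → M 0 x = c)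
    (hstep : ∀ t x, x 0 = v → ∫ w, M (t + 1) (Function.update x (t + 1) w) ∂stepLaw G (x t) = M t x)
    (hbound : ∀ t x, x 0 = v → |M t x| ≤ C)
    (hlim : ∀ᵐ x ∂walkLaw G v, ∀ᶠ t in atTop, M t x = F x) :
    ∫ x, F x ∂walkLaw G v = c := by
  have hconst : ∀ t, ∫ x, M t x ∂walkLaw G v = c := fun t => by
    induction t with
    | zero =>
      rw [integral_congr_ae (ae_walkLaw_zero_eq.mono hzero)]
      simp
    | succ t ih =>
      rw [integral_walkLaw_succ (hdep _), integral_congr_ae (ae_walkLaw_zero_eq.mono (hstep t)), ih]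
  have htendsto : Tendsto (fun t => ∫ x, M t x ∂walkLaw G v) atTop (nhds (∫ x, F x ∂walkLaw G v)) :=
    tendsto_integral_of_dominated_convergence (fun _ => C)
      (fun t => (measurable_of_dependsOn_Iic (hdep t)).aestronglyMeasurable)
      (integrable_const C) (fun t => ae_walkLaw_zero_eq.mono (hbound t))
      (hlim.mono fun x hx => tendsto_const_nhds.congr' (hx.mono fun _ h => h.symm))
  simp only [hconst] at htendsto
  exact tendsto_nhds_unique htendsto tendsto_const_nhds

end Walk

section CompleteWalk

variable {V : Type*} [MeasurableSpace V] {v : V}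

theorem stepLaw_completeWithLoops : stepLaw (completeWithLoops V) v = uniformOn Set.univ := by
  have huniv : {w | (completeWithLoops V).Adj v w} = Set.univ :=
    Set.eq_univ_of_forall fun _ => trivial
  rw [stepLaw, huniv, if_pos ⟨v, trivial⟩]

variable [DiscreteMeasurableSpace V]

theorem integral_stepLaw_completeWithLoops [Fintype V] (f : V → ℝ) :
    ∫ w, f w ∂stepLaw (completeWithLoops V) v = (∑ w, f w) / Nat.card V := by
  have hmass : ∀ w, (stepLaw (completeWithLoops V) v).real {w} = (Nat.card V : ℝ)⁻¹ := fun w => by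
    simp [stepLaw_completeWithLoops, uniformOn_univ, Measure.real]
  rw [integral_fintype .of_finite]
  simp only [hmass, smul_eq_mul, ← Finset.mul_sum, div_eq_inv_mul]

theorem integral_walkLaw_prod [Fintype V] (f : V → ℝ) (t : ℕ) :
    ∫ x, ∏ j ∈ Finset.range t, f (x (j + 1)) ∂walkLaw (completeWithLoops V) v =
      ((∑ w, f w) / Nat.card V) ^ t := by
  induction t with
  | zero => simp
  | succ t ih =>
    have hdep : DependsOn (fun x : ℕ → V => ∏ j ∈ Finset.range (t + 1), f (x (j + 1)))
        (Set.Iic (t + 1)) := fun x y hxy => Finset.prod_congr rfl fun j hj => by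
      rw [hxy (j + 1) (Finset.mem_range.1 hj)]
    have hupdate : ∀ (x : ℕ → V) (w : V), ∏ j ∈ Finset.range t,
        f (Function.update x (t + 1) w (j + 1)) = ∏ j ∈ Finset.range t, f (x (j + 1)) :=
      fun x w => Finset.prod_congr rfl fun j hj => by
        rw [Function.update_of_ne (by simpa using (Finset.mem_range.1 hj).ne)]
    rw [integral_walkLaw_succ hdep]
    simp only [Finset.prod_range_succ, Function.update_self, hupdate, integral_const_mul,
      integral_stepLaw_completeWithLoops, integral_mul_const, ih, pow_succ]

theorem walkLaw_real_forall_ne_le [Finite V] (w : V) (t : ℕ) :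
    (walkLaw (completeWithLoops V) v).real {x | ∀ t, x t ≠ w} ≤
      ((Nat.card V - 1) / Nat.card V) ^ t := by
  cases nonempty_fintype V
  classical
  let avoids (u : V) : ℝ := 1 - if u = w then 1 else 0
  have hnonneg : ∀ u, 0 ≤ avoids u := fun u => by simp only [avoids]; split_ifs <;> simp
  have hle_one : ∀ u, avoids u ≤ 1 := fun u => by simp only [avoids]; split_ifs <;> simp
  have hsum : ∑ u, avoids u = Nat.card V - 1 := by simp [avoids]
  have hsubset : {x : ℕ → V | ∀ t, x t ≠ w} ⊆
      {x | 1 ≤ ∏ j ∈ Finset.range t, avoids (x (j + 1))} := fun x hx => by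
    have hone : ∀ j, avoids (x (j + 1)) = 1 := fun j => by simp [avoids, hx (j + 1)]
    simp [hone]
  have hint : Integrable (fun x : ℕ → V => ∏ j ∈ Finset.range t, avoids (x (j + 1)))
      (walkLaw (completeWithLoops V) v) :=
    .of_bound (Measurable.aestronglyMeasurable (by fun_prop)) 1 (.of_forall fun x => by
        rw [Real.norm_of_nonneg (Finset.prod_nonneg fun j _ => hnonneg _)]
        exact Finset.prod_le_one (fun j _ => hnonneg _) fun j _ => hle_one _)
  have hmarkov := mul_meas_ge_le_integral_of_nonneg
    (.of_forall fun x => Finset.prod_nonneg fun j _ => hnonneg _) hint 1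
  rw [one_mul, integral_walkLaw_prod, hsum] at hmarkov
  exact (measureReal_mono hsubset).trans hmarkov

theorem ae_walkLaw_exists_eq [Finite V] (w : V) :
    ∀ᵐ x ∂walkLaw (completeWithLoops V) v, ∃ t, x t = w := by
  have hcard : (1 : ℝ) ≤ Nat.card V :=
    Nat.one_le_cast.2 (Nat.card_pos_iff.2 ⟨⟨v⟩, inferInstance⟩)
  have hratio : ((Nat.card V : ℝ) - 1) / Nat.card V < 1 := by
    rw [div_lt_one (by linarith)]
    exact sub_one_lt _
  have hzero : (walkLaw (completeWithLoops V) v).real {x | ∀ t, x t ≠ w} = 0 :=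
    le_antisymm (ge_of_tendsto' (tendsto_pow_atTop_nhds_zero_of_lt_one
      (div_nonneg (by linarith) (by linarith)) hratio) (walkLaw_real_forall_ne_le w))
      measureReal_nonneg
  simpa only [ae_iff, not_exists] using (measureReal_eq_zero_iff).1 hzero

end CompleteWalk

/-! ### First times -/

section FirstTime

variable {p : ℕ → Prop} {t : ℕ}

theorem firstTime_le (ht : p t) : firstTime p ≤ t :=
  sInf_le ⟨t, rfl, ht⟩

theorem le_firstTime {a : ℕ∞} (h : ∀ t : ℕ, p t → a ≤ t) : a ≤ firstTime p :=
  le_sInf (by rintro _ ⟨t, rfl, ht⟩; exact h t ht)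

theorem firstTime_eq_coe (ht : p t) (hlt : ∀ s < t, ¬ p s) : firstTime p = t :=
  le_antisymm (firstTime_le ht) <| le_firstTime fun s hs =>
    Nat.cast_le.2 (not_lt.1 fun hst => hlt s hst hs)

theorem firstTime_eq_top (h : ∀ t, ¬ p t) : firstTime p = ⊤ :=
  top_le_iff.1 (le_firstTime fun t ht => absurd ht (h t))

theorem firstTime_eq_coe_iff : firstTime p = t ↔ p t ∧ ∀ s < t, ¬ p s := by
  classical
  refine ⟨fun h => ?_, fun h => firstTime_eq_coe h.1 h.2⟩
  by_cases hp : ∃ t, p t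
  · have hfind : firstTime p = Nat.find hp :=
      firstTime_eq_coe (Nat.find_spec hp) fun s => Nat.find_min hp
    obtain rfl : Nat.find hp = t := Nat.cast_injective (hfind.symm.trans h)
    exact ⟨Nat.find_spec hp, fun s => Nat.find_min hp⟩
  · rw [firstTime_eq_top (not_exists.1 hp)] at h
    exact absurd h (ENat.top_ne_natCast t)

theorem firstTime_or (p q : ℕ → Prop) :
    firstTime (fun t => p t ∨ q t) = min (firstTime p) (firstTime q) :=
  le_antisymm
    (le_min (le_firstTime fun _ h => firstTime_le (.inl h))
      (le_firstTime fun _ h => firstTime_le (.inr h)))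
    (le_firstTime fun _ h => h.elim (fun h => min_le_of_left_le (firstTime_le h))
      fun h => min_le_of_right_le (firstTime_le h))

theorem firstTime_eq_coe_congr {p q : ℕ → Prop} (h : ∀ s ≤ t, p s ↔ q s) :
    firstTime p = t ↔ firstTime q = t := by
  rw [firstTime_eq_coe_iff, firstTime_eq_coe_iff, h t le_rfl,
    forall₂_congr fun s hs => not_congr (h s (le_of_lt hs))]

end FirstTime

/-! ### Loop erasure -/

section LoopErasure

variable {V : Type*}

open Classical in
theorem eraseStep_of_mem {p : List V} {v : V} (hv : v ∈ p) :
    eraseStep p v = p.take (p.idxOf v + 1) := by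
  induction p with
  | nil => simp at hv
  | cons a p ih =>
    by_cases hav : a = v
    · simp [eraseStep, hav]
    · have hcons : eraseStep (a :: p) v = a :: eraseStep p v := by simp [eraseStep, hav]
      rw [hcons, ih ((List.mem_cons.1 hv).resolve_left (Ne.symm hav)), List.idxOf_cons_ne _ hav,
        List.take_succ_cons]

theorem eraseStep_of_notMem {p : List V} {v : V} (hv : v ∉ p) : eraseStep p v = p ++ [v] := by
  unfold eraseStep
  congr 1
  exact List.takeWhile_eq_self_iff.2 fun u hu => by simpa using ne_of_mem_of_not_mem hu hv

/-- The loop erasure of `X_0, …, X_t`. -/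
noncomputable def erasedPath (X : ℕ → V) (t : ℕ) : List V := loopErase ((List.range (t + 1)).map X)

variable {X Y : ℕ → V} {t : ℕ}

theorem erasedPath_zero (X : ℕ → V) : erasedPath X 0 = [X 0] := by
  simp [erasedPath, loopErase, eraseStep]

theorem erasedPath_succ (X : ℕ → V) (t : ℕ) :
    erasedPath X (t + 1) = eraseStep (erasedPath X t) (X (t + 1)) := by
  simp [erasedPath, loopErase, List.range_succ (n := t + 1)]

theorem erasedPath_congr (h : ∀ j ≤ t, X j = Y j) : erasedPath X t = erasedPath Y t :=
  congrArg loopErase (List.map_congr_left fun j hj => h j (Nat.lt_succ_iff.1 (List.mem_range.1 hj)))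

theorem head?_erasedPath (X : ℕ → V) (t : ℕ) : (erasedPath X t).head? = some (X 0) := by
  classical
  induction t with
  | zero => simp [erasedPath_zero]
  | succ t ih =>
    rw [erasedPath_succ]
    by_cases h : X (t + 1) ∈ erasedPath X t
    · rw [eraseStep_of_mem h, List.head?_take, if_neg (Nat.succ_ne_zero _), ih]
    · rw [eraseStep_of_notMem h, List.head?_append, ih, Option.some_or]

theorem erasedPath_ne_nil (X : ℕ → V) (t : ℕ) : erasedPath X t ≠ [] := fun h => by
  simpa [h] using head?_erasedPath X t

theorem nodup_erasedPath (X : ℕ → V) (t : ℕ) : (erasedPath X t).Nodup := by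
  classical
  induction t with
  | zero => simp [erasedPath_zero]
  | succ t ih =>
    rw [erasedPath_succ]
    by_cases h : X (t + 1) ∈ erasedPath X t
    · rw [eraseStep_of_mem h]
      exact ih.sublist (List.take_sublist _ _)
    · rw [eraseStep_of_notMem h]
      exact ih.append (List.nodup_singleton _) (List.disjoint_singleton.2 h)

theorem exists_eq_of_mem_erasedPath {v : V} (h : v ∈ erasedPath X t) : ∃ j ≤ t, X j = v := by
  induction t with
  | zero =>
    rw [erasedPath_zero, List.mem_singleton] at h
    exact ⟨0, le_rfl, h.symm⟩
  | succ t ih =>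
    rw [erasedPath_succ, eraseStep, List.mem_append, List.mem_singleton] at h
    rcases h with h | rfl
    · obtain ⟨j, hj, hjv⟩ := ih (List.takeWhile_subset _ h)
      exact ⟨j, hj.trans t.le_succ, hjv⟩
    · exact ⟨t + 1, le_rfl, rfl⟩

theorem notMem_of_mem_erasedPath {A : Set V} (h : ∀ j ≤ t, X j ∉ A) {v : V}
    (hv : v ∈ erasedPath X t) : v ∉ A := by
  obtain ⟨j, hj, rfl⟩ := exists_eq_of_mem_erasedPath hv
  exact h j hj

theorem exists_erasedPath_eq_append {A : Set V} (ht : X t ∈ A) (hlt : ∀ j < t, X j ∉ A) :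
    ∃ q : List V, erasedPath X t = q ++ [X t] ∧ q.Nodup ∧ ∀ v ∈ q, v ∉ A := by
  cases t with
  | zero => exact ⟨[], by simp [erasedPath_zero]⟩
  | succ t =>
    have hoff : ∀ v ∈ erasedPath X t, v ∉ A := fun v =>
      notMem_of_mem_erasedPath fun j hj => hlt j (Nat.lt_succ_iff.2 hj)
    refine ⟨erasedPath X t, ?_, nodup_erasedPath X t, hoff⟩
    rw [erasedPath_succ, eraseStep_of_notMem fun hmem => hoff _ hmem ht]

end LoopErasure

section AddBranch

variable {V : Type*} {X Y : ℕ → V} {t : ℕ} {T T' : PartialTree V}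

theorem addBranch_eq_some (ht : X t ∈ T.verts) (hlt : ∀ j < t, X j ∉ T.verts) :
    addBranch T X = some (T.addPath (erasedPath X t)) := by
  have hfirst : firstTime (fun t => X t ∈ T.verts) = t := firstTime_eq_coe ht hlt
  simp [addBranch, hfirst, PartialTree.addPath, erasedPath]

theorem addBranch_ne_none (h : ∃ t, X t ∈ T.verts) : addBranch T X ≠ none := by
  classical
  rw [addBranch_eq_some (Nat.find_spec h) fun j => Nat.find_min h]
  exact Option.some_ne_none _

theorem addBranch_eq_some_iff : addBranch T X = some T' ↔
    ∃ t, (X t ∈ T.verts ∧ ∀ j < t, X j ∉ T.verts) ∧ T.addPath (erasedPath X t) = T' := by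
  classical
  refine ⟨fun h => ?_, ?_⟩
  · by_cases hX : ∃ t, X t ∈ T.verts
    · refine ⟨Nat.find hX, ⟨Nat.find_spec hX, fun j => Nat.find_min hX⟩, ?_⟩
      rw [addBranch_eq_some (Nat.find_spec hX) fun j => Nat.find_min hX] at h
      exact Option.some.inj h
    · simp [addBranch, firstTime_eq_top (not_exists.1 hX)] at h
  · rintro ⟨t, ⟨ht, hlt⟩, rfl⟩
    exact addBranch_eq_some ht hlt

theorem addBranch_congr (hXY : ∀ j ≤ t, X j = Y j) (hhit : ∃ s ≤ t, X s ∈ T.verts) :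
    addBranch T X = addBranch T Y := by
  classical
  obtain ⟨s, hst, hs⟩ := hhit
  have hX : ∃ s, X s ∈ T.verts := ⟨s, hs⟩
  have hle : Nat.find hX ≤ t := (Nat.find_min' hX hs).trans hst
  have hXY' : ∀ j ≤ Nat.find hX, X j = Y j := fun j hj => hXY j (hj.trans hle)
  rw [addBranch_eq_some (Nat.find_spec hX) fun j => Nat.find_min hX, erasedPath_congr hXY',
    addBranch_eq_some (hXY' _ le_rfl ▸ Nat.find_spec hX) fun j hj =>
      hXY' j hj.le ▸ Nat.find_min hX hj]

theorem GrownFrom.of_addBranch_eq_some {r : V} (hT : GrownFrom r T) (h : addBranch T X = some T') :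
    GrownFrom r T' := by
  obtain ⟨t, ⟨ht, hlt⟩, rfl⟩ := addBranch_eq_some_iff.1 h
  obtain ⟨q, hq, hnodup, hoff⟩ := exists_erasedPath_eq_append ht hlt
  exact hq ▸ hT.addPath ht hnodup hoff

theorem edges_subset_of_addBranch_eq_some (h : addBranch T X = some T') : T.edges ⊆ T'.edges := by
  obtain ⟨t, -, rfl⟩ := addBranch_eq_some_iff.1 h
  exact Set.subset_union_left

theorem verts_ssubset_of_addBranch_eq_some (hX : X 0 ∉ T.verts) (h : addBranch T X = some T') :
    T.verts ⊂ T'.verts := by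
  obtain ⟨t, -, rfl⟩ := addBranch_eq_some_iff.1 h
  exact Set.ssubset_iff_exists.2
    ⟨Set.subset_union_left, X 0, Or.inr (List.mem_of_head? (head?_erasedPath X t)), hX⟩

variable [Finite V]

instance : Finite (PartialTree V) :=
  Finite.of_injective (fun T => (T.verts, T.edges)) fun _ _ h =>
    PartialTree.ext (congrArg Prod.fst h) (congrArg Prod.snd h)

variable [MeasurableSpace V]

theorem measurable_of_measurableSet_eq_some {F : (ℕ → V) → Outcome V}
    (h : ∀ T, MeasurableSet {x | F x = some T}) : Measurable F := by
  refine measurable_to_countable' fun o => ?_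
  cases o with
  | some T => exact h T
  | none =>
    have hcompl : F ⁻¹' {none} = (⋃ T, {x | F x = some T})ᶜ := by
      ext x
      simp [Option.eq_none_iff_forall_ne_some]
    exact hcompl ▸ (MeasurableSet.iUnion h).compl

theorem measurable_addBranch [DiscreteMeasurableSpace V] (T : PartialTree V) :
    Measurable (addBranch T) := by
  refine measurable_of_measurableSet_eq_some fun T' => ?_
  simp only [addBranch_eq_some_iff, Set.ofPred_exists]
  refine MeasurableSet.iUnion fun t => measurableSet_setOfPred.2
    (measurable_of_dependsOn_Iic (t := t) fun x y hxy => ?_)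
  rw [erasedPath_congr hxy, hxy t (Set.mem_Iic.2 le_rfl),
    forall₂_congr fun j hj => by rw [hxy j (le_of_lt hj)]]

end AddBranch

/-! ### The likelihood along a branch of Wilson's algorithm -/

section BranchPotential

variable {V : Type*} {S : SimpleGraph V} {r : V} {k : ℕ}

open Classical in
/-- The share of `branchPotential` that is due to the next step of the walk going from the last
vertex of `q` to its parent. -/
noncomputable def chainWeight (S : SimpleGraph V) (r : V) (k : ℕ) (q : List V) : ℝ :=
  if q.IsChain fun u v => parent S r u = v then completionProb V (k + q.length) / Nat.card V else 0

/-- The share of `branchPotential` that is kept as long as `q` is not cut back and the walk does not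
enter the tree. -/
noncomputable def loopWeight (S : SimpleGraph V) (r : V) (k : ℕ) (q : List V) : ℝ :=
  ∑ j ∈ Finset.range q.length, chainWeight S r k (q.take (j + 1)) / (k + j)

/-- The expected likelihood of `S` after a branch of Wilson's algorithm off a tree with `k` vertices
contained in `S`, given that the loop erasure of the branch is `q` so far. -/
noncomputable def branchPotential (S : SimpleGraph V) (r : V) (k : ℕ) (q : List V) : ℝ :=
  loopWeight S r k q + chainWeight S r k q

theorem loopWeight_take {q : List V} {j : ℕ} (hj : j ≤ q.length) :
    loopWeight S r k (q.take j) =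
      ∑ i ∈ Finset.range j, chainWeight S r k (q.take (i + 1)) / (k + i) := by
  rw [loopWeight, List.length_take_of_le hj]
  refine Finset.sum_congr rfl fun i hi => ?_
  rw [List.take_take, min_eq_left (Finset.mem_range.1 hi)]

theorem loopWeight_append_singleton (q : List V) (w : V) :
    loopWeight S r k (q ++ [w]) =
      loopWeight S r k q + chainWeight S r k (q ++ [w]) / (k + q.length) := by
  have htake : loopWeight S r k q = loopWeight S r k ((q ++ [w]).take q.length) := by
    rw [List.take_left]
  rw [htake, loopWeight_take (by simp), loopWeight, List.length_append, List.length_singleton,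
    Finset.sum_range_succ, List.take_of_length_le (i := q.length + 1) (by simp)]

theorem sum_branchPotential_take (hk : k ≠ 0) (q : List V) :
    ∑ j ∈ Finset.range q.length, branchPotential S r k (q.take (j + 1)) =
      (k + q.length) * loopWeight S r k q := by
  induction q using List.reverseRecOn with
  | nil => simp [loopWeight]
  | append_singleton q w ih =>
    have hpos : (k : ℝ) + q.length ≠ 0 := by positivity
    have hagree : ∀ j ∈ Finset.range q.length,
        branchPotential S r k ((q ++ [w]).take (j + 1)) = branchPotential S r k (q.take (j + 1)) :=
      fun j hj => by rw [List.take_append_of_le_length (Finset.mem_range.1 hj)]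
    rw [List.length_append, List.length_singleton, Finset.sum_range_succ,
      Finset.sum_congr rfl hagree, ih, List.take_of_length_le (i := q.length + 1) (by simp),
      branchPotential, loopWeight_append_singleton]
    push_cast
    field_simp
    ring

open Classical in
theorem branchPotential_append_singleton [Finite V] (hk : k ≠ 0) (q : List V) (w : V) :
    branchPotential S r k (q ++ [w]) = loopWeight S r k q +
      if (q ++ [w]).IsChain fun u v => parent S r u = v then completionProb V (k + q.length)
      else 0 := by
  have hn : (Nat.card V : ℝ) ≠ 0 := natCast_card_ne_zero w
  have hpos : (k : ℝ) + q.length ≠ 0 := by positivity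
  have hsucc := succ_mul_completionProb_succ (V := V) (k := k + q.length) (by lia)
  push_cast at hsucc
  rw [branchPotential, loopWeight_append_singleton, add_assoc, chainWeight, List.length_append,
    List.length_singleton, ← add_assoc k]
  split_ifs
  · field_simp
    linear_combination hsucc
  · simp

theorem branchPotential_singleton [Finite V] (hk : k ≠ 0) (w : V) :
    branchPotential S r k [w] = completionProb V k := by
  simpa [loopWeight] using branchPotential_append_singleton (S := S) (r := r) hk [] w

open Classical in
theorem branchPotential_eraseStep [Finite V] (hS : S.IsTree) (hk : k ≠ 0) {q : List V}
    (hr : r ∉ q) (w : V) :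
    branchPotential S r k (eraseStep q w) = loopWeight S r k q
      + (if w ∈ q then branchPotential S r k (q.take (q.idxOf w + 1)) - loopWeight S r k q else 0)
      + if (q ++ [w]).IsChain fun u v => parent S r u = v then completionProb V (k + q.length)
        else 0 := by
  by_cases hw : w ∈ q
  · have hchain : ¬ (q ++ [w]).IsChain fun u v => parent S r u = v := fun h =>
      parent_notMem_of_isChain hS.connected hr h hw
    rw [eraseStep_of_mem hw, if_pos hw, if_neg hchain, add_zero, add_sub_cancel]
  · rw [eraseStep_of_notMem hw, if_neg hw, add_zero, branchPotential_append_singleton hk]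

variable [Fintype V]

open Classical in
theorem sum_ite_mem_idxOf {q : List V} (hq : q.Nodup) (f : ℕ → ℝ) :
    (∑ w, if w ∈ q then f (q.idxOf w) else 0) = ∑ j ∈ Finset.range q.length, f j := by
  have hmap : q.map (fun w => f (q.idxOf w)) = (List.range q.length).map f :=
    List.ext_getElem (by simp) fun j hj _ => by
      simp [hq.idxOf_getElem]
  have hmem : ∀ w, w ∈ q ↔ w ∈ q.toFinset := fun w => List.mem_toFinset.symm
  simp only [hmem, Finset.sum_ite_mem, Finset.univ_inter, List.sum_toFinset _ hq, hmap]
  rfl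

open Classical in
theorem sum_ite_isChain_append_singleton {q : List V} (hne : q ≠ []) (c : ℝ) :
    (∑ w, if (q ++ [w]).IsChain fun u v => parent S r u = v then c else 0) =
      if q.IsChain fun u v => parent S r u = v then c else 0 := by
  have hiff : ∀ w, ((q ++ [w]).IsChain fun u v => parent S r u = v) ↔
      (q.IsChain fun u v => parent S r u = v) ∧ parent S r (q.getLast hne) = w := fun w => by
    simp [List.isChain_append, List.getLast?_eq_some_getLast hne]
  simp only [hiff, ite_and]
  split_ifs <;> simp

variable {T : PartialTree V}

open Classical in
/-- Harmonicity of the potential: the next vertex `w` of the walk is in the tree, or it closes a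
loop, or it extends the loop-erased path. -/
theorem sum_branchPotential_eraseStep (hS : S.IsTree) (hT : GrownFrom r T)
    (hsub : T.edges ⊆ S.edgeSet) {q : List V} (hq : q.Nodup) (hne : q ≠ [])
    (hoff : ∀ v ∈ q, v ∉ T.verts) :
    (∑ w, if w ∈ T.verts then likelihood S (some (T.addPath (q ++ [w])))
      else branchPotential S r T.verts.ncard (eraseStep q w)) =
      Nat.card V * branchPotential S r T.verts.ncard q := by
  set k := T.verts.ncard with hk
  have hk0 : k ≠ 0 := Set.ncard_ne_zero_of_mem hT.root_mem
  have hr : r ∉ q := fun h => hoff r h hT.root_mem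
  have hterm : ∀ w, (if w ∈ T.verts then likelihood S (some (T.addPath (q ++ [w])))
      else branchPotential S r k (eraseStep q w)) = loopWeight S r k q
      + (if w ∈ q then branchPotential S r k (q.take (q.idxOf w + 1)) - loopWeight S r k q else 0)
      + (if (q ++ [w]).IsChain fun u v => parent S r u = v then completionProb V (k + q.length)
        else 0) - if w ∈ T.verts then loopWeight S r k q else 0 := fun w => by
    by_cases hwT : w ∈ T.verts
    · have hwq : w ∉ q := fun h => hoff w h hwT
      simp [likelihood, hT.addPath_edges_subset_iff hS hwT hq hoff, hsub, hwT, hwq,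
        PartialTree.ncard_verts_addPath_append_singleton hwT hq hoff, hk]
    · rw [if_neg hwT, if_neg hwT, sub_zero, branchPotential_eraseStep hS hk0 hr]
  have htree : (∑ w, if w ∈ T.verts then loopWeight S r k q else 0) = k * loopWeight S r k q := by
    rw [← Finset.sum_filter, Finset.sum_const, nsmul_eq_mul, hk,
      Set.ncard_eq_toFinset_card' T.verts, Set.filter_mem_univ_eq_toFinset]
  have hn : (Nat.card V : ℝ) ≠ 0 := natCast_card_ne_zero r
  have hchain : Nat.card V * chainWeight S r k q =
      if q.IsChain fun u v => parent S r u = v then completionProb V (k + q.length) else 0 := by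
    rw [chainWeight, mul_ite, mul_div_cancel₀ _ hn, mul_zero]
  simp only [hterm, Finset.sum_add_distrib, Finset.sum_sub_distrib, Finset.sum_const, htree,
    sum_ite_mem_idxOf hq fun j => branchPotential S r k (q.take (j + 1)) - loopWeight S r k q,
    sum_branchPotential_take hk0, sum_ite_isChain_append_singleton hne, ← hchain,
    Finset.card_univ, Finset.card_range, nsmul_eq_mul, ← Nat.card_eq_fintype_card]
  rw [branchPotential]
  ring

end BranchPotential

/-! ### A round of Wilson's algorithm preserves the likelihood -/

section WilsonBranch

open Filter

variable {V : Type*} {S : SimpleGraph V} {r v : V} {T : PartialTree V} {X Y : ℕ → V} {t : ℕ}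

open Classical in
/-- The conditional expectation of the likelihood of `S` after the branch of Wilson's algorithm off
`T ⊆ S` that follows `X`, given the trajectory up to time `t`. -/
noncomputable def branchMartingale (S : SimpleGraph V) (r : V) (T : PartialTree V) (t : ℕ)
    (X : ℕ → V) : ℝ :=
  if ∃ s ≤ t, X s ∈ T.verts then likelihood S (addBranch T X)
  else branchPotential S r T.verts.ncard (erasedPath X t)

theorem branchMartingale_congr (hXY : ∀ j ≤ t, X j = Y j) :
    branchMartingale S r T t X = branchMartingale S r T t Y := by
  have hhit : (∃ s ≤ t, X s ∈ T.verts) ↔ ∃ s ≤ t, Y s ∈ T.verts :=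
    exists_congr fun s => and_congr_right fun hs => by rw [hXY s hs]
  by_cases h : ∃ s ≤ t, X s ∈ T.verts
  · rw [branchMartingale, branchMartingale, if_pos h, if_pos (hhit.1 h), addBranch_congr hXY h]
  · rw [branchMartingale, branchMartingale, if_neg h, if_neg (hhit.not.1 h), erasedPath_congr hXY]

theorem forall_update_succ_eq (X : ℕ → V) (t : ℕ) (w : V) :
    ∀ j ≤ t, Function.update X (t + 1) w j = X j := fun _ hj =>
  Function.update_of_ne (Nat.lt_succ_of_le hj).ne _ _

open Classical in
theorem branchMartingale_succ_update (h : ∀ s ≤ t, X s ∉ T.verts) (w : V) :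
    branchMartingale S r T (t + 1) (Function.update X (t + 1) w) =
      if w ∈ T.verts then likelihood S (some (T.addPath (erasedPath X t ++ [w])))
      else branchPotential S r T.verts.ncard (eraseStep (erasedPath X t) w) := by
  have hagree := forall_update_succ_eq X t w
  have hoff : ∀ s ≤ t, Function.update X (t + 1) w s ∉ T.verts := fun s hs => by
    rw [hagree s hs]
    exact h s hs
  have herased :
      erasedPath (Function.update X (t + 1) w) (t + 1) = eraseStep (erasedPath X t) w := by
    rw [erasedPath_succ, erasedPath_congr hagree, Function.update_self]
  by_cases hw : w ∈ T.verts
  · have hlast : Function.update X (t + 1) w (t + 1) ∈ T.verts := by rwa [Function.update_self]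
    have hnot : w ∉ erasedPath X t := fun hmem => notMem_of_mem_erasedPath h hmem hw
    rw [branchMartingale, if_pos ⟨t + 1, le_rfl, hlast⟩, if_pos hw,
      addBranch_eq_some hlast fun s hs => hoff s (Nat.lt_succ_iff.1 hs), herased,
      eraseStep_of_notMem hnot]
  · have hnever : ¬ ∃ s ≤ t + 1, Function.update X (t + 1) w s ∈ T.verts := by
      rintro ⟨s, hs, hmem⟩
      rcases hs.lt_or_eq with hlt | rfl
      · exact hoff s (Nat.lt_succ_iff.1 hlt) hmem
      · exact hw (by rwa [Function.update_self] at hmem)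
    rw [branchMartingale, if_neg hnever, if_neg hw, herased]

theorem branchMartingale_zero [Finite V] (hT : GrownFrom r T) (hsub : T.edges ⊆ S.edgeSet)
    (hX : X 0 ∉ T.verts) : branchMartingale S r T 0 X = likelihood S (some T) := by
  have hnever : ¬ ∃ s ≤ 0, X s ∈ T.verts := by simpa using hX
  rw [branchMartingale, if_neg hnever, erasedPath_zero, likelihood, if_pos hsub,
    branchPotential_singleton (Set.ncard_ne_zero_of_mem hT.root_mem)]

theorem exists_abs_branchMartingale_le [Finite V] (S : SimpleGraph V) (r : V) (T : PartialTree V) :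
    ∃ C, ∀ t X, |branchMartingale S r T t X| ≤ C := by
  cases nonempty_fintype V
  classical
  obtain ⟨C, hC⟩ := (Set.finite_range fun o => |likelihood S o|).bddAbove
  obtain ⟨D, hD⟩ := (Set.finite_range fun q : {q : List V // q.Nodup} =>
    |branchPotential S r T.verts.ncard q|).bddAbove
  refine ⟨max C D, fun t X => ?_⟩
  rw [branchMartingale]
  split_ifs
  · exact le_max_of_le_left (hC ⟨_, rfl⟩)
  · exact le_max_of_le_right (hD ⟨⟨erasedPath X t, nodup_erasedPath X t⟩, rfl⟩)

variable [Finite V] [MeasurableSpace V] [DiscreteMeasurableSpace V]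

theorem integral_branchMartingale_succ (hS : S.IsTree) (hT : GrownFrom r T)
    (hsub : T.edges ⊆ S.edgeSet) (t : ℕ) (X : ℕ → V) :
    ∫ w, branchMartingale S r T (t + 1) (Function.update X (t + 1) w)
      ∂stepLaw (completeWithLoops V) (X t) = branchMartingale S r T t X := by
  cases nonempty_fintype V
  by_cases h : ∃ s ≤ t, X s ∈ T.verts
  · have hconst : ∀ w, branchMartingale S r T (t + 1) (Function.update X (t + 1) w) =
        branchMartingale S r T t X := fun w => by
      obtain ⟨s, hs, hmem⟩ := h
      have hagree := forall_update_succ_eq X t w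
      have hmem' : Function.update X (t + 1) w s ∈ T.verts := by rwa [hagree s hs]
      rw [branchMartingale, branchMartingale, if_pos ⟨s, hs.trans t.le_succ, hmem'⟩,
        if_pos ⟨s, hs, hmem⟩, addBranch_congr hagree ⟨s, hs, hmem'⟩]
    simp [hconst]
  · have hoff : ∀ s ≤ t, X s ∉ T.verts := by simpa using h
    have hn : (Nat.card V : ℝ) ≠ 0 := natCast_card_ne_zero r
    simp only [branchMartingale_succ_update hoff, integral_stepLaw_completeWithLoops]
    rw [sum_branchPotential_eraseStep hS hT hsub (nodup_erasedPath X t) (erasedPath_ne_nil X t)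
      fun v => notMem_of_mem_erasedPath hoff, mul_div_cancel_left₀ _ hn, branchMartingale, if_neg h]

theorem integral_likelihood_addBranch (hS : S.IsTree) (hT : GrownFrom r T) (hv : v ∉ T.verts) :
    ∫ x, likelihood S (addBranch T x) ∂walkLaw (completeWithLoops V) v =
      likelihood S (some T) := by
  by_cases hsub : T.edges ⊆ S.edgeSet
  · obtain ⟨C, hC⟩ := exists_abs_branchMartingale_le S r T
    refine integral_eq_of_eventually_eq (M := branchMartingale S r T)
      (fun t x y hxy => branchMartingale_congr hxy)
      (fun x hx => branchMartingale_zero hT hsub (hx ▸ hv))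
      (fun t x _ => integral_branchMartingale_succ hS hT hsub t x) (fun t x _ => hC t x) ?_
    filter_upwards [ae_walkLaw_exists_eq r] with x ⟨s, hs⟩
    filter_upwards [eventually_ge_atTop s] with t ht
    exact if_pos ⟨s, ht, hs ▸ hT.root_mem⟩
  · have hzero : ∀ x, likelihood S (addBranch T x) = 0 := fun x => by
      cases h : addBranch T x with
      | none => rfl
      | some T' =>
        exact if_neg fun hsub' => hsub ((edges_subset_of_addBranch_eq_some h).trans hsub')
    rw [likelihood, if_neg hsub]
    simp [hzero]

end WilsonBranch

/-! ### The Aldous–Broder tree -/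

section AldousBroderPath

variable {V : Type*} {X Y : ℕ → V} {s t i : ℕ}

theorem visited_zero (X : ℕ → V) : visited X 0 = {X 0} := by
  ext v; simp [visited, eq_comm]

theorem visited_succ (X : ℕ → V) (t : ℕ) :
    visited X (t + 1) = insert (X (t + 1)) (visited X t) := by
  ext v
  simp [visited, Nat.le_succ_iff, or_and_right, exists_or, or_comm, eq_comm]

theorem visited_congr (h : ∀ j ≤ t, X j = Y j) : visited X t = visited Y t :=
  Set.ext fun v => exists_congr fun k => and_congr_right fun hk => by rw [h k hk]

theorem fresh_succ_iff : Fresh X (t + 1) ↔ X (t + 1) ∉ visited X t := by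
  simp [Fresh, visited]

theorem fresh_congr (h : ∀ j ≤ t, X j = Y j) : Fresh X t ↔ Fresh Y t := by
  unfold Fresh
  rw [h t le_rfl]
  exact forall₂_congr fun k hk => by rw [h k hk.le]

theorem aldousBroderTree_zero (X : ℕ → V) : aldousBroderTree X 0 = rootTree (X 0) :=
  PartialTree.ext (visited_zero X) (by simp [aldousBroderTree, rootTree])

theorem aldousBroderTree_succ_of_notMem (h : X (t + 1) ∉ visited X t) :
    aldousBroderTree X (t + 1) = (aldousBroderTree X t).addLeaf (X t) (X (t + 1)) := by
  refine PartialTree.ext (visited_succ X t) (Set.ext fun e => ?_)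
  simp [aldousBroderTree, PartialTree.addLeaf, le_iff_lt_or_eq, or_and_right,
    exists_or, or_comm, fresh_succ_iff, h]

theorem aldousBroderTree_succ_of_mem (h : X (t + 1) ∈ visited X t) :
    aldousBroderTree X (t + 1) = aldousBroderTree X t := by
  refine PartialTree.ext ((visited_succ X t).trans (Set.insert_eq_of_mem h)) (Set.ext fun e => ?_)
  simp [aldousBroderTree, le_iff_lt_or_eq, or_and_right, exists_or,
    fresh_succ_iff, h]

theorem aldousBroderTree_congr (h : ∀ j ≤ t, X j = Y j) :
    aldousBroderTree X t = aldousBroderTree Y t := by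
  refine PartialTree.ext (visited_congr h) (Set.ext fun e => exists_congr fun k =>
    and_congr_right fun hk => ?_)
  rw [fresh_congr fun j hj => h j (hj.trans hk), h k hk.le, h (k + 1) hk]

theorem grownFrom_aldousBroderTree (X : ℕ → V) (t : ℕ) :
    GrownFrom (X 0) (aldousBroderTree X t) := by
  induction t with
  | zero => exact aldousBroderTree_zero X ▸ .root
  | succ t ih =>
    by_cases h : X (t + 1) ∈ visited X t
    · exact aldousBroderTree_succ_of_mem h ▸ ih
    · exact aldousBroderTree_succ_of_notMem h ▸ ih.leaf ⟨t, le_rfl, rfl⟩ h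

end AldousBroderPath

section BranchTime

variable {V : Type*} {X Y : ℕ → V} {s t i : ℕ}

theorem le_coe_congr {a b : ℕ∞} (h : ∀ s ≤ t, a = s ↔ b = s) (hs : s ≤ t) : a ≤ s ↔ b ≤ s := by
  simp only [ENat.le_natCast_iff]
  exact exists_congr fun u => and_congr_left fun hu => h u (hu.trans hs)

theorem lt_coe_congr {a b : ℕ∞} (h : ∀ s ≤ t, a = s ↔ b = s) (hs : s ≤ t) : a < s ↔ b < s := by
  rw [lt_iff_le_and_ne, lt_iff_le_and_ne, le_coe_congr h hs, Ne, Ne, h s hs]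

theorem sigmaIn_eq_coe_congr (hfresh : ∀ s ≤ t, Fresh X s ↔ Fresh Y s)
    (hcover : ∀ s ≤ t, visited X s = Set.univ ↔ visited Y s = Set.univ) (i : ℕ) :
    ∀ s ≤ t, sigmaIn X i = s ↔ sigmaIn Y i = s := by
  induction i with
  | zero => exact fun s _ => Iff.rfl
  | succ i ih =>
    have hout : ∀ s ≤ t, nextOut X (sigmaIn X i) = s ↔ nextOut Y (sigmaIn Y i) = s := fun s hs => by
      simp only [nextOut, coverTime, ← firstTime_or]
      refine firstTime_eq_coe_congr fun u hu => ?_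
      rw [lt_coe_congr ih (hu.trans hs), hfresh u (hu.trans hs), hcover u (hu.trans hs)]
    intro s hs
    simp only [sigmaIn, nextIn, coverTime, ← firstTime_or]
    refine firstTime_eq_coe_congr fun u hu => ?_
    rw [lt_coe_congr hout (hu.trans hs), hfresh u (hu.trans hs), hcover u (hu.trans hs)]

theorem sigmaIn_eq_coe_congr_of_eq (h : ∀ j ≤ t, X j = Y j) (i : ℕ) :
    ∀ s ≤ t, sigmaIn X i = s ↔ sigmaIn Y i = s :=
  sigmaIn_eq_coe_congr (fun _ hs => fresh_congr fun j hj => h j (hj.trans hs))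
    (fun _ hs => by rw [visited_congr fun j hj => h j (hj.trans hs)]) i

theorem visited_eq_univ_of_sigmaIn_eq (h : sigmaIn X i = (t + 1 : ℕ)) (hfresh : Fresh X (t + 1)) :
    visited X (t + 1) = Set.univ := by
  cases i with
  | zero => exact absurd h.symm (Nat.cast_ne_zero.2 t.succ_ne_zero)
  | succ i =>
    simp only [sigmaIn, nextIn, coverTime, ← firstTime_or] at h
    exact (firstTime_eq_coe_iff.1 h).1.resolve_left fun hnot => hnot.2 hfresh

theorem sigmaIn_le_coverTime (X : ℕ → V) (i : ℕ) : sigmaIn X i ≤ coverTime X := by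
  cases i with
  | zero => exact zero_le
  | succ i => exact min_le_right _ _

theorem coverTime_ne_top [Finite V] (h : ∀ v, ∃ t, X t = v) : coverTime X ≠ ⊤ := by
  choose τ hτ using h
  obtain ⟨t, ht⟩ := (Set.finite_range τ).bddAbove
  have hcover : visited X t = Set.univ :=
    Set.eq_univ_of_forall fun v => ⟨τ v, ht ⟨v, rfl⟩, hτ v⟩
  exact ((firstTime_le hcover).trans_lt (ENat.natCast_lt_top t)).ne

theorem branchTree_of_sigmaIn_eq (h : sigmaIn X i = t) :
    branchTree i X = some (aldousBroderTree X t) := by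
  simp [branchTree, h]

theorem branchTree_eq_some_iff {T : PartialTree V} :
    branchTree i X = some T ↔ ∃ t : ℕ, sigmaIn X i = t ∧ aldousBroderTree X t = T := by
  refine ⟨fun h => ?_, fun ⟨t, ht, hT⟩ => hT ▸ branchTree_of_sigmaIn_eq ht⟩
  cases hσ : sigmaIn X i with
  | top => simp [branchTree, hσ] at h
  | coe t => exact ⟨t, rfl, Option.some.inj ((branchTree_of_sigmaIn_eq hσ).symm.trans h)⟩

theorem sigmaIn_le_congr (h : ∀ j ≤ t, X j = Y j) : sigmaIn X i ≤ t ↔ sigmaIn Y i ≤ t :=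
  le_coe_congr (sigmaIn_eq_coe_congr_of_eq h i) le_rfl

theorem branchTree_congr (h : ∀ j ≤ t, X j = Y j) (hX : sigmaIn X i ≤ t) :
    branchTree i X = branchTree i Y := by
  obtain ⟨s, hs, hst⟩ := ENat.le_natCast_iff.1 hX
  rw [branchTree_of_sigmaIn_eq hs, branchTree_of_sigmaIn_eq
    ((sigmaIn_eq_coe_congr_of_eq h i s hst).1 hs),
    aldousBroderTree_congr fun j hj => h j (hj.trans hst)]

theorem sigmaIn_update_le_iff {w w' : V} (hw : w ∈ visited X t)
    (hw' : w' ∈ visited X t) :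
    sigmaIn (Function.update X (t + 1) w) i ≤ (t + 1 : ℕ) ↔
      sigmaIn (Function.update X (t + 1) w') i ≤ (t + 1 : ℕ) := by
  have hvisited : ∀ u s, s ≤ t → visited (Function.update X (t + 1) u) s = visited X s :=
    fun u s hs => visited_congr fun j hj => forall_update_succ_eq X t u j (hj.trans hs)
  have hnotFresh : ∀ u ∈ visited X t, ¬ Fresh (Function.update X (t + 1) u) (t + 1) := fun u hu =>
    fresh_succ_iff.not_left.2 (by rwa [hvisited u t le_rfl, Function.update_self])
  have hlast : ∀ u ∈ visited X t, visited (Function.update X (t + 1) u) (t + 1) = visited X t :=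
    fun u hu => by
      rw [visited_succ, hvisited u t le_rfl, Function.update_self, Set.insert_eq_of_mem hu]
  refine le_coe_congr (sigmaIn_eq_coe_congr (fun s hs => ?_) (fun s hs => ?_) i) le_rfl <;>
    rcases hs.lt_or_eq with hlt | rfl
  · have hst := Nat.lt_succ_iff.1 hlt
    exact (fresh_congr fun j hj => forall_update_succ_eq X t w j (hj.trans hst)).trans
      (fresh_congr fun j hj => forall_update_succ_eq X t w' j (hj.trans hst)).symm
  · exact iff_of_false (hnotFresh w hw) (hnotFresh w' hw')
  · rw [hvisited w s (Nat.lt_succ_iff.1 hlt), hvisited w' s (Nat.lt_succ_iff.1 hlt)]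
  · rw [hlast w hw, hlast w' hw']

theorem measurable_branchTree [Finite V] [MeasurableSpace V] [DiscreteMeasurableSpace V] (i : ℕ) :
    Measurable (branchTree (V := V) i) := by
  refine measurable_of_measurableSet_eq_some fun T => ?_
  simp only [branchTree_eq_some_iff, Set.ofPred_exists]
  refine MeasurableSet.iUnion fun t => measurableSet_setOfPred.2
    (measurable_of_dependsOn_Iic (t := t) fun x y hxy => ?_)
  rw [aldousBroderTree_congr hxy, sigmaIn_eq_coe_congr_of_eq hxy i t le_rfl]

end BranchTime

/-! ### The branches of the Aldous–Broder algorithm preserve the likelihood -/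

section ExplorationPotential

variable {V : Type*} [Fintype V] {S : SimpleGraph V} {r x y : V} {T : PartialTree V}

open Classical in
/-- The conditional expectation of the likelihood of `S` when the current branch of the
Aldous–Broder algorithm is finished, given the tree `T` built so far and the position `y` of the
walk in it. -/
noncomputable def explorationPotential (S : SimpleGraph V) (r : V) (T : PartialTree V) (y : V) :
    ℝ :=
  if T.edges ⊆ S.edgeSet then
    T.verts.ncard * completionProb V T.verts.ncard / Nat.card V * entryCount S r T.verts y
  else 0

theorem explorationPotential_of_verts_eq_univ (hT : T.verts = Set.univ) :
    explorationPotential S r T y = likelihood S (some T) := by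
  have hn : (Nat.card V : ℝ) ≠ 0 := natCast_card_ne_zero r
  rw [explorationPotential, likelihood, hT, entryCount_univ, Set.ncard_univ, Nat.cast_one, mul_one,
    mul_div_cancel_left₀ _ hn]

open Classical in
theorem sum_explorationPotential_mem (hS : S.Connected) (hr : r ∈ T.verts) :
    ∑ w with w ∈ T.verts, explorationPotential S r T w =
      ∑ w with w ∈ T.verts, likelihood S (some T) := by
  have hn : (Nat.card V : ℝ) ≠ 0 := natCast_card_ne_zero r
  have hcard : (Finset.univ.filter (· ∈ T.verts)).card = T.verts.ncard := by
    rw [Set.ncard_eq_toFinset_card', Set.filter_mem_univ_eq_toFinset]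
  by_cases hsub : T.edges ⊆ S.edgeSet
  · simp only [explorationPotential, likelihood, if_pos hsub, ← Finset.mul_sum, ← Nat.cast_sum,
      sum_entryCount hS hr, Finset.sum_const, hcard, nsmul_eq_mul, div_mul_cancel₀ _ hn]
  · simp only [explorationPotential, likelihood, if_neg hsub]

open Classical in
theorem explorationPotential_addLeaf (hS : S.IsTree) (hT : GrownFrom r T)
    (hsub : T.edges ⊆ S.edgeSet) (hx : x ∈ T.verts) (hy : y ∉ T.verts) :
    explorationPotential S r (T.addLeaf x y) y = if parent S r y = x then
      T.verts.ncard * completionProb V T.verts.ncard * entryCount S r (insert y T.verts) y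
    else 0 := by
  have hn : (Nat.card V : ℝ) ≠ 0 := natCast_card_ne_zero r
  have hverts : (T.addLeaf x y).verts = insert y T.verts := rfl
  rw [explorationPotential, hT.addLeaf_edges_subset_iff hS hx hy, hverts,
    Set.ncard_insert_of_notMem hy, Nat.cast_succ,
    succ_mul_completionProb_succ (Set.ncard_ne_zero_of_mem hT.root_mem),
    mul_div_cancel_left₀ _ hn]
  simp only [hsub, true_and]

open Classical in
theorem sum_explorationPotential (hS : S.IsTree) (hT : GrownFrom r T) (hx : x ∈ T.verts) :
    ∑ w with w ∈ T.verts, explorationPotential S r T w +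
        ∑ w with w ∉ T.verts, explorationPotential S r (T.addLeaf x w) w =
      Nat.card V * explorationPotential S r T x := by
  have hn : (Nat.card V : ℝ) ≠ 0 := natCast_card_ne_zero r
  by_cases hsub : T.edges ⊆ S.edgeSet
  · rw [Finset.sum_congr (s₁ := Finset.univ.filter (· ∉ T.verts)) rfl fun w hw =>
        explorationPotential_addLeaf hS hT hsub hx (Finset.mem_filter_univ w |>.1 hw),
      ← Finset.sum_filter, Finset.filter_filter, ← Finset.mul_sum]
    simp only [explorationPotential, if_pos hsub, ← Finset.mul_sum, ← Nat.cast_sum,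
      sum_entryCount hS.1 hT.root_mem, entryCount_eq_one_add_sum hS.1 hT.root_mem hx]
    push_cast
    field_simp
  · have hleaf : ∀ w, ¬ (T.addLeaf x w).edges ⊆ S.edgeSet := fun w h =>
      hsub ((Set.subset_insert _ _).trans h)
    simp [explorationPotential, hsub, hleaf]

end ExplorationPotential

section ExplorationMartingale

variable {V : Type*} [Fintype V] {S : SimpleGraph V} {r : V} {X Y : ℕ → V} {i t : ℕ}

open Classical in
/-- The conditional expectation of the likelihood of `S` after `i` branches of the Aldous–Broder
algorithm driven by `X`, given the trajectory up to time `t`. -/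
noncomputable def explorationMartingale (S : SimpleGraph V) (r : V) (i t : ℕ) (X : ℕ → V) : ℝ :=
  if sigmaIn X i ≤ t then likelihood S (branchTree i X)
  else explorationPotential S r (aldousBroderTree X t) (X t)

theorem explorationMartingale_congr (h : ∀ j ≤ t, X j = Y j) :
    explorationMartingale S r i t X = explorationMartingale S r i t Y := by
  by_cases hX : sigmaIn X i ≤ t
  · rw [explorationMartingale, explorationMartingale, if_pos hX, if_pos ((sigmaIn_le_congr h).1 hX),
      branchTree_congr h hX]
  · rw [explorationMartingale, explorationMartingale, if_neg hX,
      if_neg (mt (sigmaIn_le_congr h).2 hX), aldousBroderTree_congr h, h t le_rfl]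

theorem explorationMartingale_zero (hS : S.Connected) :
    explorationMartingale S (X 0) i 0 X = likelihood S (some (rootTree (X 0))) := by
  rw [explorationMartingale]
  split_ifs with h
  · rw [branchTree_of_sigmaIn_eq (le_antisymm h zero_le), aldousBroderTree_zero]
  · classical
    have hsingleton : Finset.univ.filter (· ∈ (rootTree (X 0)).verts) = {X 0} := by
      ext; simp [rootTree]
    have hsum := sum_explorationPotential_mem (T := rootTree (X 0)) hS (Set.mem_singleton _)
    rw [aldousBroderTree_zero]
    rwa [hsingleton, Finset.sum_singleton, Finset.sum_singleton] at hsum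

open Classical in
theorem explorationMartingale_succ (h : ¬ sigmaIn X i ≤ t) :
    explorationMartingale S r i (t + 1) X = if sigmaIn X i ≤ (t + 1 : ℕ) then
      likelihood S (some (aldousBroderTree X (t + 1)))
    else explorationPotential S r (aldousBroderTree X (t + 1)) (X (t + 1)) := by
  rw [explorationMartingale]
  split_ifs with hle
  · obtain ⟨s, hs, hst⟩ := ENat.le_natCast_iff.1 hle
    obtain rfl : s = t + 1 :=
      hst.antisymm (Nat.lt_of_not_le fun hle => h (hs ▸ Nat.cast_le.2 hle))
    rw [branchTree_of_sigmaIn_eq hs]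
  · rfl

theorem explorationMartingale_succ_of_notMem (h : ¬ sigmaIn X i ≤ t)
    (hX : X (t + 1) ∉ visited X t) :
    explorationMartingale S r i (t + 1) X = explorationPotential S r
      ((aldousBroderTree X t).addLeaf (X t) (X (t + 1))) (X (t + 1)) := by
  rw [explorationMartingale_succ h, ← aldousBroderTree_succ_of_notMem hX]
  split_ifs with hle
  · have hσ : sigmaIn X i = (t + 1 : ℕ) :=
      le_antisymm hle (by exact_mod_cast Order.add_one_le_of_lt (not_le.1 h))
    exact (explorationPotential_of_verts_eq_univ
      (visited_eq_univ_of_sigmaIn_eq hσ (fresh_succ_iff.2 hX))).symm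
  · rfl

open Classical in
theorem sum_explorationMartingale_mem (hS : S.Connected) (h : ¬ sigmaIn X i ≤ t)
    (hr : r ∈ visited X t) :
    ∑ w with w ∈ visited X t, explorationMartingale S r i (t + 1) (Function.update X (t + 1) w) =
      ∑ w with w ∈ visited X t, explorationPotential S r (aldousBroderTree X t) w := by
  have hvalue : ∀ w ∈ visited X t,
      explorationMartingale S r i (t + 1) (Function.update X (t + 1) w) =
        if sigmaIn (Function.update X (t + 1) r) i ≤ (t + 1 : ℕ) then
          likelihood S (some (aldousBroderTree X t))
        else explorationPotential S r (aldousBroderTree X t) w := fun w hw => by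
    have hagree := forall_update_succ_eq X t w
    have hw' : Function.update X (t + 1) w (t + 1) ∈ visited (Function.update X (t + 1) w) t := by
      rwa [Function.update_self, visited_congr hagree]
    rw [explorationMartingale_succ (mt (sigmaIn_le_congr hagree).1 h),
      aldousBroderTree_succ_of_mem hw', aldousBroderTree_congr hagree, Function.update_self]
    simp only [sigmaIn_update_le_iff hw hr]
  rw [Finset.sum_congr rfl fun w hw => hvalue w (Finset.mem_filter_univ w |>.1 hw)]
  split_ifs
  · exact (sum_explorationPotential_mem (T := aldousBroderTree X t) hS hr).symm
  · rfl

theorem exists_abs_explorationMartingale_le (S : SimpleGraph V) (r : V) (i : ℕ) :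
    ∃ C, ∀ t X, |explorationMartingale S r i t X| ≤ C := by
  obtain ⟨C, hC⟩ := (Set.finite_range fun o => |likelihood S o|).bddAbove
  obtain ⟨D, hD⟩ := (Set.finite_range fun p : PartialTree V × V =>
    |explorationPotential S r p.1 p.2|).bddAbove
  refine ⟨max C D, fun t X => ?_⟩
  rw [explorationMartingale]
  split_ifs
  · exact le_max_of_le_left (hC ⟨_, rfl⟩)
  · exact le_max_of_le_right (hD ⟨(_, _), rfl⟩)

variable [MeasurableSpace V] [DiscreteMeasurableSpace V]

theorem integral_explorationMartingale_succ (hS : S.IsTree) (t : ℕ) (X : ℕ → V) :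
    ∫ w, explorationMartingale S (X 0) i (t + 1) (Function.update X (t + 1) w)
      ∂stepLaw (completeWithLoops V) (X t) = explorationMartingale S (X 0) i t X := by
  classical
  have hn : (Nat.card V : ℝ) ≠ 0 := natCast_card_ne_zero (X 0)
  by_cases h : sigmaIn X i ≤ t
  · have hconst : ∀ w, explorationMartingale S (X 0) i (t + 1) (Function.update X (t + 1) w) =
        explorationMartingale S (X 0) i t X := fun w => by
      have hagree : ∀ j ≤ t, X j = Function.update X (t + 1) w j := fun j hj =>
        (forall_update_succ_eq X t w j hj).symm
      have hle := (sigmaIn_le_congr hagree).1 h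
      rw [explorationMartingale, explorationMartingale, if_pos h,
        if_pos (hle.trans (Nat.cast_le.2 t.le_succ)), branchTree_congr hagree h]
    simp [hconst]
  · have hnotMem : ∀ w ∉ visited X t,
        explorationMartingale S (X 0) i (t + 1) (Function.update X (t + 1) w) =
          explorationPotential S (X 0) ((aldousBroderTree X t).addLeaf (X t) w) w := fun w hw => by
      have hagree := forall_update_succ_eq X t w
      rw [explorationMartingale_succ_of_notMem (mt (sigmaIn_le_congr hagree).1 h)
        (by rwa [Function.update_self, visited_congr hagree]), aldousBroderTree_congr hagree,
        Function.update_self, hagree t le_rfl]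
    rw [integral_stepLaw_completeWithLoops,
      ← Finset.sum_filter_add_sum_filter_not _ (· ∈ visited X t),
      sum_explorationMartingale_mem hS.1 h ⟨0, zero_le, rfl⟩,
      Finset.sum_congr rfl fun w hw => hnotMem w (Finset.mem_filter_univ w |>.1 hw),
      explorationMartingale, if_neg h, div_eq_iff hn, mul_comm]
    exact sum_explorationPotential hS (grownFrom_aldousBroderTree X t) ⟨t, le_rfl, rfl⟩

end ExplorationMartingale

section AldousBroderBranches

variable {V : Type*} [Finite V] [MeasurableSpace V] [DiscreteMeasurableSpace V]

theorem ae_sigmaIn_ne_top (r : V) (i : ℕ) :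
    ∀ᵐ x ∂walkLaw (completeWithLoops V) r, sigmaIn x i ≠ ⊤ := by
  filter_upwards [ae_all_iff.2 fun w => ae_walkLaw_exists_eq w] with x hx
  exact ne_top_of_le_ne_top (coverTime_ne_top hx) (sigmaIn_le_coverTime x i)

theorem integral_likelihood_branchTree {S : SimpleGraph V} (hS : S.IsTree) (r : V) (i : ℕ) :
    ∫ x, likelihood S (branchTree i x) ∂walkLaw (completeWithLoops V) r =
      likelihood S (some (rootTree r)) := by
  cases nonempty_fintype V
  obtain ⟨C, hC⟩ := exists_abs_explorationMartingale_le S r i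
  refine integral_eq_of_eventually_eq (M := explorationMartingale S r i)
    (fun t x y hxy => explorationMartingale_congr hxy)
    (fun x hx => hx ▸ explorationMartingale_zero hS.1)
    (fun t x hx => hx ▸ integral_explorationMartingale_succ hS t x) (fun t x _ => hC t x) ?_
  filter_upwards [ae_sigmaIn_ne_top r i] with x hx
  obtain ⟨s, hs⟩ := ENat.ne_top_iff_exists.1 hx
  filter_upwards [Filter.eventually_ge_atTop s] with t ht
  exact if_pos (hs ▸ Nat.cast_le.2 ht)

end AldousBroderBranches

/-! ### Uniform measures -/

section UniformOn

variable {α β : Type*} [MeasurableSpace α] [DiscreteMeasurableSpace α] [MeasurableSpace β]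
  [DiscreteMeasurableSpace β]

theorem ae_uniformOn_mem (s : Set α) : ∀ᵐ a ∂uniformOn s, a ∈ s :=
  ae_cond_mem .of_discrete

theorem eq_uniformOn {μ : Measure α} [IsProbabilityMeasure μ] {s : Set α} (hs : s.Finite)
    {c : ENNReal} (hconst : ∀ a ∈ s, μ {a} = c) (hmem : ∀ᵐ a ∂μ, a ∈ s) : μ = uniformOn s := by
  have hsubset : ∀ t ⊆ s, μ t = Measure.count t * c := fun t hts => by
    lift t to Finset α using hs.subset hts
    rw [← sum_measure_singleton, Finset.sum_congr rfl fun a ha => hconst a (hts ha),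
      Finset.sum_const, nsmul_eq_mul, Measure.count_apply_finset]
  have hinter : ∀ t, μ t = μ (s ∩ t) := fun t =>
    measure_congr (hmem.mono fun a ha => propext ⟨fun h => ⟨ha, h⟩, fun h => h.2⟩)
  have htotal : Measure.count s * c = 1 := by
    rw [← hsubset s subset_rfl, ← Set.inter_univ s, ← hinter, measure_univ]
  ext t -
  rw [hinter, hsubset _ Set.inter_subset_left, uniformOn, cond_apply .of_discrete, mul_comm,
    ENNReal.eq_inv_of_mul_eq_one_left ((mul_comm _ _).trans htotal)]

theorem map_uniformOn {f : α → β} (hf : f.Injective) (s : Set α) :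
    (uniformOn s).map f = uniformOn (f '' s) := by
  ext t -
  rw [Measure.map_apply .of_discrete .of_discrete, uniformOn, uniformOn, cond_apply .of_discrete,
    cond_apply .of_discrete, ← Set.image_inter_preimage, Measure.count_injective_image hf,
    Measure.count_injective_image hf]

end UniformOn

/-! ### Uniform completions of a partial tree -/

section UniformCompletion

variable {V : Type*} {r : V} {T : PartialTree V}

instance : DiscreteMeasurableSpace (Outcome V) := ⟨fun _ => trivial⟩

instance : DiscreteMeasurableSpace (SimpleGraph V) := ⟨fun _ => trivial⟩

/-- `ν` is the law of a procedure that almost surely completes `T` to a spanning tree, and that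
returns each spanning tree `S` with probability `likelihood S (some T)`: the law of the uniform
spanning tree conditioned to contain `T`. -/
structure IsUniformCompletion (ν : Measure (Outcome V)) (T : PartialTree V) : Prop where
  isProbabilityMeasure : IsProbabilityMeasure ν
  apply_singleton : ∀ S : SimpleGraph V, S.IsTree →
    ν {some (ofSimpleGraph S)} = ENNReal.ofReal (likelihood S (some T))
  ae_isTree : ∀ᵐ o ∂ν, ∃ S : SimpleGraph V, S.IsTree ∧ some (ofSimpleGraph S) = o

theorem IsUniformCompletion.bind {μ : Measure (Outcome V)} [IsProbabilityMeasure μ]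
    {run : PartialTree V → Measure (Outcome V)}
    (hrun : ∀ᵐ o ∂μ, ∃ T', o = some T' ∧ IsUniformCompletion (run T') T')
    (hmean : ∀ S : SimpleGraph V, S.IsTree →
      ∫⁻ o, ENNReal.ofReal (likelihood S o) ∂μ = ENNReal.ofReal (likelihood S (some T))) :
    IsUniformCompletion (μ.bind (andThen run)) T where
  isProbabilityMeasure := isProbabilityMeasure_bind Measurable.of_discrete.aemeasurable <| by
    filter_upwards [hrun]
    rintro _ ⟨T', rfl, h⟩
    exact h.isProbabilityMeasure
  apply_singleton S hS := by
    rw [Measure.bind_apply .of_discrete Measurable.of_discrete.aemeasurable, ← hmean S hS]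
    refine lintegral_congr_ae ?_
    filter_upwards [hrun]
    rintro _ ⟨T', rfl, h⟩
    exact h.apply_singleton S hS
  ae_isTree := by
    rw [ae_iff, Measure.bind_apply .of_discrete Measurable.of_discrete.aemeasurable,
      lintegral_eq_zero_iff .of_discrete]
    filter_upwards [hrun]
    rintro _ ⟨T', rfl, h⟩
    exact h.ae_isTree

variable [Finite V]

theorem isUniformCompletion_dirac (hT : GrownFrom r T) (hfull : T.verts = Set.univ) :
    IsUniformCompletion (Measure.dirac (some T)) T where
  isProbabilityMeasure := inferInstance
  apply_singleton S hS := by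
    have : Nonempty V := ⟨r⟩
    rw [Measure.dirac_apply' _ .of_discrete, likelihood, hfull, Set.ncard_univ, completionProb_card,
      hT.edges_subset_iff_of_verts_eq_univ hfull hS]
    by_cases h : T = ofSimpleGraph S <;> simp [h]
  ae_isTree := by
    obtain ⟨S, hS, hST⟩ := hT.exists_isTree hfull
    rw [ae_dirac_eq]
    exact ⟨S, hS, hST ▸ rfl⟩

theorem IsUniformCompletion.eq_map_UST {ν : Measure (Outcome V)}
    (hν : IsUniformCompletion ν (rootTree r)) :
    ν = (UST (completeWithLoops V)).map fun S => some (ofSimpleGraph S) := by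
  have := hν.isProbabilityMeasure
  have hspanning : spanningTrees (completeWithLoops V) = {S | S.IsTree} :=
    Set.ext fun S => ⟨fun h => h.2, fun h => ⟨fun _ _ hvw => ⟨hvw.ne, trivial⟩, h⟩⟩
  have hinj : Function.Injective fun S : SimpleGraph V => (some (ofSimpleGraph S) : Outcome V) :=
    fun _ _ h => SimpleGraph.edgeSet_injective (congrArg PartialTree.edges (Option.some.inj h))
  rw [UST, hspanning, map_uniformOn hinj]
  refine eq_uniformOn (c := ENNReal.ofReal (completionProb V 1)) (Set.toFinite _) ?_ hν.ae_isTree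
  rintro _ ⟨S, hS, rfl⟩
  rw [hν.apply_singleton S hS, rootTree, likelihood, if_pos (Set.empty_subset _),
    Set.ncard_singleton]

end UniformCompletion

/-! ### The hybrid algorithm -/

section Hybrid

variable {V : Type*} [Finite V] [MeasurableSpace V] [DiscreteMeasurableSpace V] {r : V}
  {T : PartialTree V}

theorem lintegral_likelihood_map_walkLaw (S : SimpleGraph V) (v : V) {F : (ℕ → V) → Outcome V}
    (hF : Measurable F) :
    ∫⁻ o, ENNReal.ofReal (likelihood S o) ∂(walkLaw (completeWithLoops V) v).map F =
      ENNReal.ofReal (∫ x, likelihood S (F x) ∂walkLaw (completeWithLoops V) v) := by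
  have hint : Integrable (likelihood S) ((walkLaw (completeWithLoops V) v).map F) :=
    have := Measure.isProbabilityMeasure_map (μ := walkLaw (completeWithLoops V) v) hF.aemeasurable
    .of_finite
  rw [← integral_map hF.aemeasurable hint.1,
    ofReal_integral_eq_lintegral_ofReal hint (.of_forall (likelihood_nonneg S))]

theorem isProbabilityMeasure_uniformOn_compl (hfull : T.verts ≠ Set.univ) :
    IsProbabilityMeasure (uniformOn T.vertsᶜ) :=
  isProbabilityMeasure_uniformOn (Set.toFinite _) (Set.nonempty_compl.2 hfull)

theorem isProbabilityMeasure_wilsonRound (hfull : T.verts ≠ Set.univ) :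
    IsProbabilityMeasure (wilsonRound (completeWithLoops V) T) :=
  have := isProbabilityMeasure_uniformOn_compl hfull
  isProbabilityMeasure_bind Measurable.of_discrete.aemeasurable <| .of_forall fun _ =>
    Measure.isProbabilityMeasure_map (measurable_addBranch T).aemeasurable

theorem lintegral_likelihood_wilsonRound {S : SimpleGraph V} (hS : S.IsTree) (hT : GrownFrom r T)
    (hfull : T.verts ≠ Set.univ) :
    ∫⁻ o, ENNReal.ofReal (likelihood S o) ∂wilsonRound (completeWithLoops V) T =
      ENNReal.ofReal (likelihood S (some T)) := by
  have := isProbabilityMeasure_uniformOn_compl hfull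
  have hbranch : ∀ᵐ v ∂uniformOn T.vertsᶜ,
      ∫⁻ o, ENNReal.ofReal (likelihood S o) ∂(walkLaw (completeWithLoops V) v).map (addBranch T) =
        ENNReal.ofReal (likelihood S (some T)) := by
    filter_upwards [ae_uniformOn_mem T.vertsᶜ] with v hv
    rw [lintegral_likelihood_map_walkLaw S v (measurable_addBranch T),
      integral_likelihood_addBranch hS hT hv]
  rw [wilsonRound, Measure.lintegral_bind Measurable.of_discrete.aemeasurable
    Measurable.of_discrete.aemeasurable, lintegral_congr_ae hbranch, lintegral_const, measure_univ,
    mul_one]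

theorem ae_wilsonRound (hT : GrownFrom r T) :
    ∀ᵐ o ∂wilsonRound (completeWithLoops V) T,
      ∃ T', o = some T' ∧ GrownFrom r T' ∧ T.verts ⊂ T'.verts := by
  rw [ae_iff, wilsonRound, Measure.bind_apply .of_discrete Measurable.of_discrete.aemeasurable,
    lintegral_eq_zero_iff .of_discrete]
  filter_upwards [ae_uniformOn_mem T.vertsᶜ] with v hv
  refine (ae_map_iff (measurable_addBranch T).aemeasurable .of_discrete).2 ?_
  filter_upwards [ae_walkLaw_zero_eq, ae_walkLaw_exists_eq r] with x hx ⟨t, ht⟩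
  cases h : addBranch T x with
  | none => exact absurd h (addBranch_ne_none ⟨t, ht ▸ hT.root_mem⟩)
  | some T' =>
    exact ⟨T', rfl, hT.of_addBranch_eq_some h, verts_ssubset_of_addBranch_eq_some (hx ▸ hv) h⟩

theorem isUniformCompletion_wilsonLoop {k : ℕ} (hT : GrownFrom r T)
    (hk : Nat.card V ≤ T.verts.ncard + k) :
    IsUniformCompletion (wilsonLoop (completeWithLoops V) k T) T := by
  induction k generalizing T with
  | zero =>
    have hfull : T.verts = Set.univ :=
      (Set.eq_univ_iff_ncard _).2 (le_antisymm (Set.ncard_le_card _) hk)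
    rw [wilsonLoop, if_pos hfull]
    exact isUniformCompletion_dirac hT hfull
  | succ k ih =>
    rw [wilsonLoop]
    split_ifs with hfull
    · exact isUniformCompletion_dirac hT hfull
    · have := isProbabilityMeasure_wilsonRound hfull
      refine .bind ?_ fun S hS => lintegral_likelihood_wilsonRound hS hT hfull
      filter_upwards [ae_wilsonRound hT]
      rintro _ ⟨T', rfl, hT', hssub⟩
      have hcard := Set.ncard_lt_ncard hssub
      exact ⟨T', rfl, ih hT' (by omega)⟩

theorem isUniformCompletion_wilson (hT : GrownFrom r T) :
    IsUniformCompletion (wilson (completeWithLoops V) T) T :=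
  isUniformCompletion_wilsonLoop hT (Nat.le_add_left _ _)

theorem ae_aldousBroderLaw (r : V) (i : ℕ) :
    ∀ᵐ o ∂aldousBroderLaw (completeWithLoops V) r i, ∃ T, o = some T ∧ GrownFrom r T := by
  refine (ae_map_iff (measurable_branchTree i).aemeasurable .of_discrete).2 ?_
  filter_upwards [ae_walkLaw_zero_eq, ae_sigmaIn_ne_top r i] with x hx hσ
  obtain ⟨t, ht⟩ := ENat.ne_top_iff_exists.1 hσ
  exact ⟨_, branchTree_of_sigmaIn_eq ht.symm, hx ▸ grownFrom_aldousBroderTree x t⟩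

theorem isUniformCompletion_hybrid (r : V) (i : ℕ) :
    IsUniformCompletion ((aldousBroderLaw (completeWithLoops V) r i).bind
      (andThen (wilson (completeWithLoops V)))) (rootTree r) := by
  have : IsProbabilityMeasure (aldousBroderLaw (completeWithLoops V) r i) :=
    Measure.isProbabilityMeasure_map (measurable_branchTree i).aemeasurable
  refine .bind ?_ fun S hS => ?_
  · filter_upwards [ae_aldousBroderLaw r i]
    rintro _ ⟨T, rfl, hT⟩
    exact ⟨T, rfl, isUniformCompletion_wilson hT⟩
  · rw [aldousBroderLaw, lintegral_likelihood_map_walkLaw S r (measurable_branchTree i),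
      integral_likelihood_branchTree hS]

end Hybrid

end HybridUST

theorem mainTheorem4 {V : Type*} [Finite V] [MeasurableSpace V] [DiscreteMeasurableSpace V]
    (r : V) (i : ℕ) :
    (HybridUST.aldousBroderLaw (HybridUST.completeWithLoops V) r i).bind
        (HybridUST.andThen (HybridUST.wilson (HybridUST.completeWithLoops V))) =
      (HybridUST.UST (HybridUST.completeWithLoops V)).map
        (fun T => some (HybridUST.ofSimpleGraph T)) :=
  (HybridUST.isUniformCompletion_hybrid r i).eq_map_UST
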